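/- Let $n$ be a positive integer. A \emph{$k$-space group} is a discrete group $\Gamma$ of isometries of Euclidean $k$-space $E^k$ whose orbit space $E^k/\Gamma$ is compact. Isometries are written $a+A$ (meaning $x\mapsto a+Ax$, with $a\in E^k$ and $A\in\mathrm{O}(k)$). For a normal subgroup $\mathrm{N}$ of a $k$-space group $\Gamma$, let $V=\mathrm{Span}\{a\in E^k : a+I\in\mathrm{N}\}$; then $\mathrm{N}$ is a \emph{complete} normal subgroup of $\Gamma$ if $\mathrm{N}=\{a+A\in\Gamma : a\in V \text{ and } V^\perp\subseteq\mathrm{Fix}(A)\}$. Let $\mathrm{M}$ be an $(n-1)$-space group and let $\Delta$ be an infinite cyclic $1$-space group. Let $\mathrm{Iso}(\Delta,\mathrm{M})$ be the set of isomorphism classes $[\Gamma,\mathrm{N}]$ of pairs $(\Gamma,\mathrm{N})$, where $\Gamma$ is an $n$-space group and $\mathrm{N}$ is a complete normal subgroup of $\Gamma$ such that $\mathrm{N}$ is isomorphic to $\mathrm{M}$ and $\Gamma/\mathrm{N}$ is isomorphic to $\Delta$; an isomorphism $(\Gamma_1,\mathrm{N}_1)\to(\Gamma_2,\mathrm{N}_2)$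 of pairs is a group isomorphism $\Gamma_1\to\Gamma_2$ that maps $\mathrm{N}_1$ onto $\mathrm{N}_2$. Let $\mathrm{Out}(\mathrm{M})=\mathrm{Aut}(\mathrm{M})/\mathrm{Inn}(\mathrm{M})$, and let $\mathrm{Out}(\mathrm{M})$ act by conjugation on unordered pairs of its elements. Then $\mathrm{Iso}(\Delta,\mathrm{M})$ is in one-to-one correspondence with the set of conjugacy classes of unordered pairs $\{g,g^{-1}\}$ of inverse elements of $\mathrm{Out}(\mathrm{M})$ of finite order. If $[\Gamma,\mathrm{N}]\in\mathrm{Iso}(\Delta,\mathrm{M})$, $\alpha:\mathrm{N}\to\mathrm{M}$ is an isomorphism, and $\gamma$ is an element of $\Gamma$ such that $\mathrm{N}\gamma$ generates $\Gamma/\mathrm{N}$, then under this correspondence $[\Gamma,\mathrm{N}]$ corresponds to the conjugacy class of the pair of inverse elements $\{\alpha\gamma_\ast\alpha^{-1}\mathrm{Inn}(\mathrm{M}),\ \alpha\gamma_\ast^{-1}\alpha^{-1}\mathrm{Inn}(\mathrm{M})\}$ of $\mathrm{Out}(\mathrm{M})$, where $\gamma_\ast$ is the automorphism $\nu\mapsto\gamma\nu\gamma^{-1}$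 of $\mathrm{N}$. -/

import Mathlib

noncomputable section

namespace SpaceGroup

/-- Euclidean `n`-space. -/
abbrev E (n : ℕ) : Type := EuclideanSpace ℝ (Fin n)

/-- The group of isometries `x ↦ a + A x`, with `A` orthogonal, of Euclidean `n`-space;
multiplication is composition. -/
abbrev Isom (n : ℕ) : Type := E n ≃ᵃⁱ[ℝ] E n

/-- The topology on the isometry group inherited from the compact-open topology on the space of
continuous self-maps. -/
instance isomTopology (n : ℕ) : TopologicalSpace (Isom n) :=
  TopologicalSpace.induced (fun f : Isom n => (⟨f, f.continuous⟩ : C(E n, E n))) inferInstance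

/-- The isometry group acts on Euclidean space by evaluation. -/
instance isomAction (n : ℕ) : MulAction (Isom n) (E n) where
  smul f x := f x
  one_smul _ := rfl
  mul_smul _ _ _ := rfl

/-- An `n`-space group: a discrete group of isometries of Euclidean `n`-space with compact
orbit space (with the quotient topology). -/
structure IsSpaceGroup {n : ℕ} (Γ : Subgroup (Isom n)) : Prop where
  discrete : IsDiscrete (Γ : Set (Isom n))
  cocompact : CompactSpace (Quotient (MulAction.orbitRel Γ (E n)))

/-- The span of a subgroup `N` of `Γ`: the linear span of all `a` such that the translation
`x ↦ a + x` lies in `N`. -/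
def span {n : ℕ} {Γ : Subgroup (Isom n)} (N : Subgroup Γ) : Submodule ℝ (E n) :=
  Submodule.span ℝ {a : E n | ∃ ν ∈ N, ∀ x : E n, (ν : Isom n) x = a + x}

/-- `N` consists of all isometries `x ↦ a + A x` in `Γ` such that `a` is in `V = span N` and
`A` fixes every vector orthogonal to `V`. Here `a` is the image of `0` and `A` is the linear
part. -/
def IsComplete {n : ℕ} {Γ : Subgroup (Isom n)} (N : Subgroup Γ) : Prop :=
  ∀ γ : Γ, γ ∈ N ↔
    ((γ : Isom n) 0 ∈ span N ∧
      ∀ w ∈ (span N)ᗮ, (γ : Isom n).linearIsometryEquiv w = w)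

/-- A pair `(Γ, N)` consisting of an `n`-space group and a complete normal subgroup. -/
structure Pair (n : ℕ) where
  Γ : Subgroup (Isom n)
  isSpaceGroup : IsSpaceGroup Γ
  N : Subgroup Γ
  normal : N.Normal
  complete : IsComplete N

attribute [instance] Pair.normal

/-- An isomorphism of pairs is a group isomorphism `Γ₁ → Γ₂` that maps `N₁` onto `N₂`. -/
def Pair.Isomorphic {n : ℕ} (P Q : Pair n) : Prop :=
  ∃ φ : P.Γ ≃* Q.Γ, P.N.map φ.toMonoidHom = Q.N

/-- The pairs `(Γ, N)`, with `Γ` an `n`-space group, such that `N ≅ M` and `Γ / N ≅ Δ`. -/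
def PairsOver (n : ℕ) {k m : ℕ} (Δ : Subgroup (Isom k)) (M : Subgroup (Isom m)) : Type :=
  {P : Pair n // Nonempty (P.N ≃* M) ∧ Nonempty (P.Γ ⧸ P.N ≃* Δ)}

/-- Isomorphism of pairs as an equivalence relation. -/
def pairSetoid (n : ℕ) {k m : ℕ} (Δ : Subgroup (Isom k)) (M : Subgroup (Isom m)) :
    Setoid (PairsOver n Δ M) where
  r P Q := P.1.Isomorphic Q.1
  iseqv :=
    { refl := fun P => ⟨MulEquiv.refl _, Subgroup.map_id _⟩
      symm := by
        rintro P Q ⟨φ, h⟩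
        refine ⟨φ.symm, ?_⟩
        rw [← h, Subgroup.map_map]
        convert Subgroup.map_id _
        ext x
        simp
      trans := by
        rintro P Q R ⟨φ, h⟩ ⟨ψ, k⟩
        exact ⟨φ.trans ψ, by rw [← k, ← h, Subgroup.map_map]; rfl⟩ }

/-- The set of isomorphism classes of pairs `(Γ, N)` where `N` is a complete normal subgroup of
an `(m + k)`-space group `Γ` with `N ≅ M` and `Γ / N ≅ Δ`, for a `k`-space group `Δ` and an
`m`-space group `M`. -/
def Iso {k m : ℕ} (Δ : Subgroup (Isom k)) (M : Subgroup (Isom m)) : Type :=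
  Quotient (pairSetoid (m + k) Δ M)

/-- The isomorphism class of a pair. -/
def Iso.mk {k m : ℕ} {Δ : Subgroup (Isom k)} {M : Subgroup (Isom m)}
    (P : PairsOver (m + k) Δ M) : Iso Δ M :=
  Quotient.mk (pairSetoid (m + k) Δ M) P

/-- The group of inner automorphisms. -/
abbrev Inn (G : Type) [Group G] : Subgroup (MulAut G) := (MulAut.conj (G := G)).range

instance innNormal (G : Type) [Group G] : (Inn G).Normal where
  conj_mem := by
    rintro _ ⟨g, rfl⟩ f
    exact ⟨f g, by ext x; simp [MulAut.conj_apply]⟩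

/-- The group of outer automorphisms. -/
abbrev Out (G : Type) [Group G] : Type := MulAut G ⧸ Inn G

/-- Conjugacy of unordered pairs of elements of a group: `{x, y}` is conjugate to
`{g x g⁻¹, g y g⁻¹}`. -/
def pairConj (G : Type) [Group G] : Setoid (Sym2 G) where
  r p q := ∃ g : G, p.map (MulAut.conj g) = q
  iseqv :=
    { refl := fun p => ⟨1, by
        induction p using Sym2.ind
        simp⟩
      symm := by
        rintro p _ ⟨g, rfl⟩
        refine ⟨g⁻¹, ?_⟩
        induction p using Sym2.ind
        simp [mul_assoc]
      trans := by
        rintro p _ _ ⟨g, rfl⟩ ⟨h, rfl⟩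
        refine ⟨h * g, ?_⟩
        induction p using Sym2.ind
        simp [mul_assoc] }

/-- The conjugacy class of the unordered pair `{x, y}`. -/
def pairClass {G : Type} [Group G] (x y : G) : Quotient (pairConj G) :=
  Quotient.mk (pairConj G) s(x, y)

/-- The set of conjugacy classes of pairs `{g, g⁻¹}` of inverse elements of finite order. -/
def InversePairClasses (G : Type) [Group G] : Set (Quotient (pairConj G)) :=
  {c | ∃ g : G, IsOfFinOrder g ∧ c = pairClass g g⁻¹}

/-- The class in `Out M` of the automorphism `α γ_* α⁻¹`, where `γ_*` is conjugation by `γ` on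
the normal subgroup `N` and `α : N → M` is an isomorphism. -/
def outClass {Γ M : Type} [Group Γ] [Group M] {N : Subgroup Γ} [N.Normal]
    (α : N ≃* M) (γ : Γ) : Out M :=
  QuotientGroup.mk (MulAut.congr α (MulAut.conjNormal γ))

end SpaceGroup

end

/-! The invariant is well defined and injective by group theory alone. A generator of the infinite
cyclic group Γ/N is unique up to inversion, and its lift `γ` up to N; changing the lift alters `γ_*`
by an inner automorphism, changing `α` conjugates the outer class (`pairClass_eq_of_map`).
Conversely ℤ is free, so Γ ≅ N ⋊ ⟨γ⟩. If the outer classes agree up to conjugation and inversion,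
lifts can be chosen that induce the same automorphism of M, so both pairs are the same semidirect
product (`exists_equiv_of_conj`).

Geometry enters twice. For finite order, Bieberbach's first theorem (`IsSpaceGroup.finite_lin`)
makes the translations T a normal abelian subgroup of finite index. Some power τ of `γ` lies in T,
and ν ↦ [τ, ν] is a crossed homomorphism from N to the abelian group T ∩ N that factors through a
finite quotient. Its power by the order of that quotient is principal, so a power of τ acts on N as
an inner automorphism (`exists_pow_conj_eq`).

For surjectivity, let φ have finite outer order. One may arrange φ^K = conj σ with φ σ = σ; then z =
σ⁻¹t^K is central in M ⋊ ⟨t⟩, and the translations of M together with z generate a normal subgroup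
of finite index. It acts on E^m with z acting trivially, and averaging over the finite quotient
extends this to an affine action of the whole group with finite linear part
(`exists_affine_action`). An averaged inner product makes the action isometric. Letting t also shift
an extra orthogonal coordinate by 1 gives a space group in which M is the subgroup of height zero,
hence complete (`exists_realization`). -/

noncomputable section

namespace SpaceGroup

/-! ### Commutator estimates for linear isometries -/

section Deviation

variable {F : Type*} [NormedAddCommGroup F] [NormedSpace ℝ F]

/-- The underlying continuous linear map of a linear isometry. -/
def toCLM (A : F ≃ₗᵢ[ℝ] F) : F →L[ℝ] F := (A.toContinuousLinearEquiv : F →L[ℝ] F)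

@[simp] lemma toCLM_apply (A : F ≃ₗᵢ[ℝ] F) (x : F) : toCLM A x = A x := rfl

/-- The operator norm distance of a linear isometry to the identity. -/
def dev (A : F ≃ₗᵢ[ℝ] F) : ℝ := ‖toCLM A - 1‖

lemma dev_nonneg (A : F ≃ₗᵢ[ℝ] F) : 0 ≤ dev A := norm_nonneg _

lemma norm_apply_sub_le (A : F ≃ₗᵢ[ℝ] F) (x : F) : ‖A x - x‖ ≤ dev A * ‖x‖ :=
  (toCLM A - 1).le_opNorm x

lemma dev_le {A : F ≃ₗᵢ[ℝ] F} {c : ℝ} (hc : 0 ≤ c) (h : ∀ x, ‖A x - x‖ ≤ c * ‖x‖) : dev A ≤ c :=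
  ContinuousLinearMap.opNorm_le_bound _ hc h

lemma inv_apply_self' (A : F ≃ₗᵢ[ℝ] F) (x : F) : A⁻¹ (A x) = x := A.symm_apply_apply x

lemma apply_inv_self' (A : F ≃ₗᵢ[ℝ] F) (x : F) : A (A⁻¹ x) = x := A.apply_symm_apply x

lemma dev_inv_mul (A B : F ≃ₗᵢ[ℝ] F) : dev (A⁻¹ * B) ≤ ‖toCLM A - toCLM B‖ := by
  refine dev_le (norm_nonneg _) fun x => ?_
  have : A⁻¹ (B x) - x = A⁻¹ (B x - A x) := by rw [map_sub, inv_apply_self']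
  rw [LinearIsometryEquiv.coe_mul, Function.comp_apply, this, LinearIsometryEquiv.norm_map,
    norm_sub_rev]
  exact (toCLM A - toCLM B).le_opNorm x

lemma dev_conj (A B : F ≃ₗᵢ[ℝ] F) : dev (A * B * A⁻¹) ≤ dev B := by
  refine dev_le (dev_nonneg _) fun x => ?_
  have : (A * B * A⁻¹) x - x = A (B (A⁻¹ x) - A⁻¹ x) := by
    rw [map_sub, apply_inv_self']; rfl
  rw [this, LinearIsometryEquiv.norm_map]
  simpa using norm_apply_sub_le B (A⁻¹ x)

lemma commutator_apply_sub (A B : F ≃ₗᵢ[ℝ] F) (x : F) :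
    (A * B * A⁻¹ * B⁻¹) x - x = A (B ((B * A)⁻¹ x)) - B (A ((B * A)⁻¹ x)) := by
  have h : B (A ((B * A)⁻¹ x)) = x := apply_inv_self' (B * A) x
  rw [h, mul_inv_rev]; rfl

/-- AB − BA = (A − 1)(B − 1) − (B − 1)(A − 1), so the commutator is quadratically small. -/
lemma dev_commutator (A B : F ≃ₗᵢ[ℝ] F) : dev (A * B * A⁻¹ * B⁻¹) ≤ 2 * dev A * dev B := by
  have hA := dev_nonneg A
  have hB := dev_nonneg B
  refine dev_le (by positivity) fun x => ?_
  rw [commutator_apply_sub]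
  have hy : ‖(B * A)⁻¹ x‖ = ‖x‖ := LinearIsometryEquiv.norm_map _ _
  rw [← hy]
  generalize (B * A)⁻¹ x = y
  have e : A (B y) - B (A y) = (A (B y - y) - (B y - y)) - (B (A y - y) - (A y - y)) := by
    simp only [map_sub]; abel
  rw [e]
  have h1 := norm_apply_sub_le A (B y - y)
  have h2 := norm_apply_sub_le B (A y - y)
  have h3 := mul_le_mul_of_nonneg_left (norm_apply_sub_le B y) hA
  have h4 := mul_le_mul_of_nonneg_left (norm_apply_sub_le A y) hB
  have h5 := norm_sub_le (A (B y - y) - (B y - y)) (B (A y - y) - (A y - y))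
  linarith

/-- AB − BA = A(B − 1) − (B − 1)A, so only B has to be near the identity. The uniformity in A allows
A to be replaced by its powers. -/
lemma dev_commutator_le (A B : F ≃ₗᵢ[ℝ] F) : dev (A * B * A⁻¹ * B⁻¹) ≤ 2 * dev B := by
  have hB := dev_nonneg B
  refine dev_le (by positivity) fun x => ?_
  rw [commutator_apply_sub]
  have hy : ‖(B * A)⁻¹ x‖ = ‖x‖ := LinearIsometryEquiv.norm_map _ _
  rw [← hy]
  generalize (B * A)⁻¹ x = y
  have e : A (B y) - B (A y) = A (B y - y) - (B (A y) - A y) := by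
    simp only [map_sub]; abel
  rw [e]
  have h1 : ‖A (B y - y)‖ = ‖B y - y‖ := LinearIsometryEquiv.norm_map _ _
  have h2 := norm_apply_sub_le B (A y)
  have h3 := norm_apply_sub_le B y
  have h4 : ‖A y‖ = ‖y‖ := LinearIsometryEquiv.norm_map _ _
  have h5 := norm_sub_le (A (B y - y)) (B (A y) - A y)
  rw [h4] at h2
  linarith

/-- The group of linear isometries has no small subgroups. -/
lemma eq_one_of_dev_pow_le (D : F ≃ₗᵢ[ℝ] F) (h : ∀ k : ℕ, dev (D ^ k) ≤ 1 / 2) : D = 1 := by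
  -- With B = D ^ k, B² − 1 = 2(B − 1) + (B − 1)², and the last term costs at most half of ‖Bx − x‖.
  -- Doubling the exponent thus stretches displacements by 3/2, which is impossible forever if they
  -- stay bounded.
  have step : ∀ k : ℕ, ∀ x, (3 / 2) * ‖(D ^ k) x - x‖ ≤ ‖(D ^ (2 * k)) x - x‖ := by
    intro k x
    have e : (D ^ (2 * k)) x - x
        = (2 : ℝ) • ((D ^ k) x - x) + ((D ^ k) ((D ^ k) x - x) - ((D ^ k) x - x)) := by
      rw [two_mul, pow_add, LinearIsometryEquiv.coe_mul, Function.comp_apply, map_sub, two_smul]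
      abel
    have h1 := norm_apply_sub_le (D ^ k) ((D ^ k) x - x)
    have h2 := mul_le_mul_of_nonneg_right (h k) (norm_nonneg ((D ^ k) x - x))
    have h3 := norm_sub_le ((D ^ (2 * k)) x - x) ((D ^ k) ((D ^ k) x - x) - ((D ^ k) x - x))
    rw [e, add_sub_cancel_right, norm_smul, Real.norm_two, ← e] at h3
    linarith
  have grow : ∀ x, ∀ j : ℕ, (3 / 2 : ℝ) ^ j * ‖D x - x‖ ≤ ‖(D ^ (2 ^ j)) x - x‖ := by
    intro x j
    induction j with
    | zero => simp
    | succ j ih =>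
      have := step (2 ^ j) x
      rw [pow_succ, pow_succ' 2 j]
      linarith
  ext1 x
  by_contra hx
  have hpos : 0 < ‖D x - x‖ := norm_pos_iff.2 (sub_ne_zero.2 hx)
  obtain ⟨j, hj⟩ := pow_unbounded_of_one_lt (1 / 2 * ‖x‖ / ‖D x - x‖)
    (by norm_num : (1 : ℝ) < 3 / 2)
  rw [div_lt_iff₀ hpos] at hj
  have h1 := norm_apply_sub_le (D ^ (2 ^ j)) x
  have h2 := mul_le_mul_of_nonneg_right (h (2 ^ j)) (norm_nonneg x)
  linarith [grow x j]

/-- If D = [A, C] commutes with A, then [A ^ k, C] = D ^ k. These stay within 2 · `dev C` ≤ 1/2 of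
the identity, so D = 1 as there are no small subgroups. -/
lemma commute_of_commute_commutator {A C : F ≃ₗᵢ[ℝ] F} (hC : dev C ≤ 1 / 4)
    (h : Commute A (A * C * A⁻¹ * C⁻¹)) : Commute A C := by
  set D := A * C * A⁻¹ * C⁻¹ with hD
  have hAC : A * C = D * C * A := by rw [hD]; group
  have hpow : ∀ k : ℕ, A ^ k * C = D ^ k * C * A ^ k := by
    intro k
    induction k with
    | zero => simp
    | succ k ih =>
      calc A ^ (k + 1) * C = A * (A ^ k * C) := by rw [pow_succ', mul_assoc]
        _ = (A * D ^ k) * C * A ^ k := by rw [ih]; group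
        _ = D ^ k * (A * C) * A ^ k := by rw [(h.pow_right k).eq]; group
        _ = D ^ (k + 1) * C * A ^ (k + 1) := by rw [hAC, pow_succ D, pow_succ' A]; group
  have h1 : D = 1 := by
    refine eq_one_of_dev_pow_le D fun k => ?_
    have : D ^ k = A ^ k * C * (A ^ k)⁻¹ * C⁻¹ := by rw [hpow]; group
    rw [this]
    linarith [dev_commutator_le (A ^ k) C]
  rw [h1, one_mul] at hAC
  exact hAC

end Deviation

/-! ### Discreteness and cocompactness in terms of orbits of the origin -/

section Isometries

variable {n : ℕ}

/-- The linear part of an isometry, as a group homomorphism. -/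
def lin : Isom n →* (E n ≃ₗᵢ[ℝ] E n) where
  toFun g := g.linearIsometryEquiv
  map_one' := rfl
  map_mul' _ _ := rfl

lemma isom_apply (g : Isom n) (x : E n) : g x = g 0 + lin g x := by
  have := g.map_vadd 0 x
  simp only [vadd_eq_add, add_zero] at this
  rw [this, add_comm]; rfl

lemma isom_mul_apply (g h : Isom n) (x : E n) : (g * h) x = g (h x) := rfl

lemma isom_mul_zero (g h : Isom n) : (g * h) 0 = g 0 + lin g (h 0) := isom_apply g (h 0)

lemma isom_inv_apply_self (g : Isom n) (x : E n) : g⁻¹ (g x) = x := g.symm_apply_apply x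

lemma isom_apply_inv_self (g : Isom n) (x : E n) : g (g⁻¹ x) = x := g.apply_symm_apply x

lemma isom_ext {g h : Isom n} (h0 : g 0 = h 0) (hl : lin g = lin h) : g = h := by
  ext1 x
  rw [isom_apply g, isom_apply h, h0, hl]

lemma isom_sub (g : Isom n) (x y : E n) : g x - g y = lin g (x - y) := by
  rw [isom_apply g x, isom_apply g y, map_sub]; abel

lemma norm_isom_sub (g : Isom n) (x y : E n) : ‖g x - g y‖ = ‖x - y‖ := by
  rw [isom_sub, LinearIsometryEquiv.norm_map]

lemma isom_inv_zero (g : Isom n) : g⁻¹ 0 = - lin g⁻¹ (g 0) := by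
  have := isom_apply g⁻¹ (g 0)
  rw [isom_inv_apply_self] at this
  exact eq_neg_of_add_eq_zero_left this.symm

lemma norm_inv_mul_zero (g h : Isom n) : ‖(g⁻¹ * h) 0‖ = ‖h 0 - g 0‖ := by
  rw [isom_mul_apply, ← sub_zero (g⁻¹ (h 0)), ← norm_isom_sub g (g⁻¹ (h 0)) 0,
    isom_apply_inv_self]

lemma continuous_eval (x : E n) : Continuous fun g : Isom n => g x := by
  have h : Continuous (fun g : Isom n => (⟨g, g.continuous⟩ : C(E n, E n))) :=
    continuous_induced_dom
  exact (continuous_eval_const x : Continuous fun f : C(E n, E n) => f x).comp h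

instance : T2Space (Isom n) := by
  refine T2Space.of_injective_continuous
    (f := fun g : Isom n => (⟨g, g.continuous⟩ : C(E n, E n))) ?_ continuous_induced_dom
  intro g h hgh
  ext1 x
  exact congrArg (fun f : C(E n, E n) => f x) hgh

/-- In a discrete group of isometries only the identity is close to the identity. -/
lemma exists_isolating {Γ : Subgroup (Isom n)} (h : IsDiscrete (Γ : Set (Isom n))) :
    ∃ ε > 0, ∀ γ ∈ Γ, ‖γ 0‖ < ε → dev (lin γ) < ε → γ = 1 := by
  have := h.to_subtype
  have h1 : IsOpen ({(1 : Γ)} : Set (Γ : Set (Isom n))) := isOpen_discrete _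
  obtain ⟨U, hU, hU1⟩ := isOpen_induced_iff.1 h1
  obtain ⟨V, hV, rfl⟩ := isOpen_induced_iff.1 hU
  -- Currying makes (a, B) ↦ (x ↦ a + Bx) continuous into the compact-open topology, so a
  -- neighbourhood of the identity contains a ball in these coordinates.
  let f : (E n × (E n →L[ℝ] E n)) → C(E n, E n) :=
    ContinuousMap.curry ⟨fun p => p.1.1 + p.1.2 p.2, by fun_prop⟩
  have hf : Continuous f := ContinuousMap.continuous _
  have hfg : ∀ g : Isom n, f (g 0, toCLM (lin g)) = ⟨g, g.continuous⟩ := by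
    intro g
    ext1 x
    exact (isom_apply g x).symm
  have hmem : ((0 : E n), (1 : E n →L[ℝ] E n)) ∈ f ⁻¹' V := by
    have h2 : (1 : Γ) ∈ ((↑) : Γ → Isom n) ⁻¹'
        ((fun g : Isom n => (⟨g, g.continuous⟩ : C(E n, E n))) ⁻¹' V) := by
      have : (1 : Γ) ∈ ({(1 : Γ)} : Set (Γ : Set (Isom n))) := rfl
      rw [← hU1] at this
      exact this
    have h3 := hfg 1
    have : toCLM (lin (1 : Isom n)) = 1 := rfl
    rw [this] at h3
    change f (0, 1) ∈ V
    have h4 : (1 : Isom n) 0 = 0 := rfl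
    rw [h4] at h3
    rw [h3]
    exact h2
  obtain ⟨ε, hε, hball⟩ := Metric.isOpen_iff.1 (hV.preimage hf) _ hmem
  refine ⟨ε, hε, fun γ hγ h0 hl => ?_⟩
  have hin : (γ 0, toCLM (lin γ)) ∈ Metric.ball ((0 : E n), (1 : E n →L[ℝ] E n)) ε := by
    rw [Metric.mem_ball, Prod.dist_eq, max_lt_iff, dist_zero_right, dist_eq_norm]
    exact ⟨h0, hl⟩
  have h5 := hball hin
  rw [Set.mem_preimage, hfg] at h5
  have h6 : (⟨γ, hγ⟩ : Γ) ∈ ({(1 : Γ)} : Set (Γ : Set (Isom n))) := by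
    rw [← hU1]; exact h5
  exact congrArg Subtype.val (Set.mem_singleton_iff.1 h6)

/-- Left translation carries finiteness near the identity to finiteness near any g, and finite sets
are closed in a Hausdorff space. Evaluation at 0 suffices. -/
lemma isDiscrete_of_finite {Γ : Subgroup (Isom n)} {ε : ℝ} (hε : 0 < ε)
    (h : {γ ∈ (Γ : Set (Isom n)) | ‖γ 0‖ < ε}.Finite) : IsDiscrete (Γ : Set (Isom n)) := by
  refine ⟨discreteTopology_iff_isOpen_singleton.2 fun g => ?_⟩
  let U : Set (Γ : Set (Isom n)) := {k | ‖(k : Isom n) 0 - (g : Isom n) 0‖ < ε}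
  have hUo : IsOpen U := by
    have : Continuous fun k : (Γ : Set (Isom n)) => ‖(k : Isom n) 0 - (g : Isom n) 0‖ :=
      (((continuous_eval 0).comp continuous_subtype_val).sub continuous_const).norm
    exact isOpen_lt this continuous_const
  have hUf : U.Finite := by
    refine Set.Finite.of_finite_image (f := fun k : (Γ : Set (Isom n)) => (g : Isom n)⁻¹ * k)
      (h.subset ?_) ?_
    · rintro _ ⟨k, hk, rfl⟩
      refine ⟨Γ.mul_mem (Γ.inv_mem g.2) k.2, ?_⟩
      rw [norm_inv_mul_zero]
      exact hk
    · intro a _ b _ hab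
      exact Subtype.ext (mul_left_cancel hab)
  have : ({g} : Set (Γ : Set (Isom n))) = U \ (U \ {g}) := by
    ext k
    simp only [Set.mem_singleton_iff, Set.mem_sdiff, not_and, not_not]
    constructor
    · rintro rfl
      exact ⟨by simpa [U] using hε, fun _ => rfl⟩
    · exact fun hk => hk.2 hk.1
  rw [this]
  exact hUo.sdiff (hUf.subset Set.sdiff_subset).isClosed

instance (Γ : Subgroup (Isom n)) : ContinuousConstSMul Γ (E n) :=
  ⟨fun γ => (γ : Isom n).continuous⟩

/-- The images of the balls about 0 form an increasing open cover of the compact orbit space, so one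
of them is everything. -/
lemma exists_covering_radius {Γ : Subgroup (Isom n)}
    (h : CompactSpace (Quotient (MulAction.orbitRel Γ (E n)))) :
    ∃ R : ℝ, ∀ x : E n, ∃ γ ∈ Γ, ‖x - γ 0‖ ≤ R := by
  let π : E n → Quotient (MulAction.orbitRel Γ (E n)) := Quotient.mk _
  have hop : IsOpenMap π := isOpenMap_quotient_mk'_mul
  obtain ⟨k, hk⟩ := isCompact_univ.elim_directed_cover
    (fun k : ℕ => π '' Metric.ball 0 k) (fun k => hop _ Metric.isOpen_ball)
    (by
      intro q _
      induction q using Quotient.ind with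
      | _ x =>
      obtain ⟨k, hk⟩ := exists_nat_gt ‖x‖
      exact Set.mem_iUnion.2 ⟨k, x, by simpa using hk, rfl⟩)
    (by
      refine Monotone.directed_le fun i j hij => ?_
      exact Set.image_mono (Metric.ball_subset_ball (by exact_mod_cast hij)))
  refine ⟨k, fun x => ?_⟩
  obtain ⟨y, hy, hyx⟩ := hk (Set.mem_univ (π x))
  obtain ⟨γ, hγ⟩ : y ∈ MulAction.orbit Γ x := Quotient.exact hyx
  have hγ' : (γ : Isom n) x = y := hγ
  refine ⟨(γ : Isom n)⁻¹, Γ.inv_mem γ.2, ?_⟩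
  rw [← norm_isom_sub (γ : Isom n), isom_apply_inv_self, hγ', sub_zero]
  exact (mem_ball_zero_iff.1 hy).le

lemma compactSpace_of_covering_radius {Γ : Subgroup (Isom n)} {R : ℝ}
    (h : ∀ x : E n, ∃ γ ∈ Γ, ‖γ x‖ ≤ R) :
    CompactSpace (Quotient (MulAction.orbitRel Γ (E n))) := by
  let π : E n → Quotient (MulAction.orbitRel Γ (E n)) := Quotient.mk _
  have hc : Continuous π := continuous_quot_mk
  refine ⟨?_⟩
  convert (isCompact_closedBall (0 : E n) R).image hc
  refine (Set.eq_univ_of_forall fun q => ?_).symm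
  induction q using Quotient.ind with
  | _ x =>
  obtain ⟨γ, hγ, hx⟩ := h x
  refine ⟨γ x, by simpa using hx, Quotient.sound ?_⟩
  exact ⟨⟨γ, hγ⟩, rfl⟩

end Isometries


/-! ### Bieberbach's first theorem -/

section Bieberbach

variable {n : ℕ}

lemma eq_zero_of_forall_norm_le {F G : Type*} [NormedAddCommGroup F] [NormedSpace ℝ F]
    [NormedAddCommGroup G] [NormedSpace ℝ G] (f : F →ₗ[ℝ] G) (C : ℝ) (h : ∀ x, ‖f x‖ ≤ C) :
    f = 0 := by
  ext x
  by_contra hx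
  have hpos : 0 < ‖f x‖ := norm_pos_iff.2 hx
  obtain ⟨k, hk⟩ := exists_nat_gt (C / ‖f x‖)
  rw [div_lt_iff₀ hpos] at hk
  have := h ((k : ℝ) • x)
  rw [map_smul, norm_smul, Real.norm_natCast] at this
  linarith

/-- The iterated commutators `[α, [α, … [α, β]]]`. -/
def iteratedCommutator {G : Type*} [Group G] (α β : G) : ℕ → G
  | 0 => β
  | j + 1 => α * iteratedCommutator α β j * α⁻¹ * (iteratedCommutator α β j)⁻¹

lemma dev_iteratedCommutator {α β : Isom n} (hα : dev (lin α) ≤ 1 / 8) (hβ : dev (lin β) ≤ 1 / 8)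
    (j : ℕ) : dev (lin (iteratedCommutator α β j)) ≤ 1 / 8 * (1 / 4) ^ j := by
  induction j with
  | zero => simpa [iteratedCommutator] using hβ
  | succ j ih =>
    have h := dev_commutator (lin α) (lin (iteratedCommutator α β j))
    rw [iteratedCommutator, map_mul, map_mul, map_mul, map_inv, map_inv]
    refine h.trans ?_
    have := mul_le_mul hα ih (dev_nonneg _) (by norm_num)
    rw [pow_succ]
    linarith

/-- Evaluating αγ = κγα at 0, with κ the commutator, expresses κ 0 as three differences of the form
Bx − x. -/
lemma norm_commutator_zero_le (α γ : Isom n) :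
    ‖(α * γ * α⁻¹ * γ⁻¹) 0‖ ≤ dev (lin γ) * ‖α 0‖
      + (dev (lin α) + dev (lin (α * γ * α⁻¹ * γ⁻¹))) * ‖γ 0‖ := by
  set κ := α * γ * α⁻¹ * γ⁻¹ with hκ
  have h1 : α * γ = κ * (γ * α) := by rw [hκ]; group
  have h2 := congrArg (fun g : Isom n => g 0) h1
  simp only [isom_mul_zero] at h2
  have h3 : lin κ (lin γ (α 0)) = (lin α * lin γ * (lin α)⁻¹) (α 0) := by
    have : lin κ * lin γ = lin α * lin γ * (lin α)⁻¹ := by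
      rw [← map_mul, hκ, ← map_inv, ← map_mul, ← map_mul]; congr 1; group
    rw [← this]; rfl
  have e : κ 0 = ((lin α (γ 0) - γ 0) - (lin κ (γ 0) - γ 0))
      - ((lin α * lin γ * (lin α)⁻¹) (α 0) - α 0) := by
    rw [← h3]
    rw [map_add] at h2
    rw [← sub_eq_zero] at h2
    refine sub_eq_zero.1 (neg_eq_zero.1 (Eq.trans ?_ h2))
    abel
  rw [e]
  have b1 := norm_apply_sub_le (lin α) (γ 0)
  have b2 := norm_apply_sub_le (lin κ) (γ 0)
  have b3 := norm_apply_sub_le (lin α * lin γ * (lin α)⁻¹) (α 0)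
  have b4 := mul_le_mul_of_nonneg_right (dev_conj (lin α) (lin γ)) (norm_nonneg (α 0))
  have b5 := norm_sub_le ((lin α (γ 0) - γ 0) - (lin κ (γ 0) - γ 0))
    ((lin α * lin γ * (lin α)⁻¹) (α 0) - α 0)
  have b6 := norm_sub_le (lin α (γ 0) - γ 0) (lin κ (γ 0) - γ 0)
  linarith

/-- The recursion is t_{j+1} ≤ t_j / 4 + (1/8)(1/4)^j ‖α 0‖. Adding (1/4)^j ‖α 0‖ to t_j absorbs the
inhomogeneous term and leaves contraction by 1/2. -/
lemma norm_iteratedCommutator {α β : Isom n} (hα : dev (lin α) ≤ 1 / 8)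
    (hβ : dev (lin β) ≤ 1 / 8) (j : ℕ) :
    ‖iteratedCommutator α β j 0‖ + (1 / 4) ^ j * ‖α 0‖ ≤ (1 / 2) ^ j * (‖β 0‖ + ‖α 0‖) := by
  induction j with
  | zero => simp [iteratedCommutator]
  | succ j ih =>
    have h := norm_commutator_zero_le α (iteratedCommutator α β j)
    have d1 := dev_iteratedCommutator hα hβ j
    have d2 := dev_iteratedCommutator hα hβ (j + 1)
    rw [iteratedCommutator] at d2 ⊢
    have d3 : (1 / 8 : ℝ) * (1 / 4) ^ (j + 1) ≤ 1 / 8 := by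
      have : (1 / 4 : ℝ) ^ (j + 1) ≤ 1 := pow_le_one₀ (by norm_num) (by norm_num)
      linarith
    have e1 := mul_le_mul_of_nonneg_right d1 (norm_nonneg (α 0))
    have e2 := mul_le_mul_of_nonneg_right (add_le_add hα (d2.trans d3))
      (norm_nonneg (iteratedCommutator α β j 0))
    have p1 : 0 ≤ (1 / 4 : ℝ) ^ j * ‖α 0‖ := by positivity
    rw [pow_succ, pow_succ]
    nlinarith [norm_nonneg (iteratedCommutator α β j 0)]

/-- Isometries with small rotation parts in a discrete group have commuting rotation parts. -/
lemma commute_lin_of_dev_le {Γ : Subgroup (Isom n)} (h : IsDiscrete (Γ : Set (Isom n)))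
    {α β : Isom n} (hαΓ : α ∈ Γ) (hβΓ : β ∈ Γ) (hα : dev (lin α) ≤ 1 / 8)
    (hβ : dev (lin β) ≤ 1 / 8) : Commute (lin α) (lin β) := by
  obtain ⟨ε, hε, hiso⟩ := exists_isolating h
  have hmem : ∀ j, iteratedCommutator α β j ∈ Γ := by
    intro j
    induction j with
    | zero => exact hβΓ
    | succ j ih =>
      exact Γ.mul_mem (Γ.mul_mem (Γ.mul_mem hαΓ ih) (Γ.inv_mem hαΓ)) (Γ.inv_mem ih)
  -- Translation and rotation parts of the iterated commutators both tend to zero, so discreteness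
  -- makes one of them trivial. Commutation then descends from that commutator to β.
  obtain ⟨j, hj⟩ : ∃ j, iteratedCommutator α β j = 1 := by
    have l1 : Filter.Tendsto (fun j : ℕ => (1 / 2 : ℝ) ^ j * (‖β 0‖ + ‖α 0‖)) Filter.atTop
        (nhds 0) := by
      simpa using (tendsto_pow_atTop_nhds_zero_of_lt_one (r := (1 / 2 : ℝ)) (by norm_num)
        (by norm_num)).mul_const (‖β 0‖ + ‖α 0‖)
    have l2 : Filter.Tendsto (fun j : ℕ => 1 / 8 * (1 / 4 : ℝ) ^ j) Filter.atTop (nhds 0) := by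
      rw [← mul_zero (1 / 8 : ℝ)]
      exact (tendsto_pow_atTop_nhds_zero_of_lt_one (by norm_num) (by norm_num)).const_mul _
    obtain ⟨j, h1, h2⟩ := ((l1.eventually_lt_const hε).and (l2.eventually_lt_const hε)).exists
    refine ⟨j, hiso _ (hmem j) ?_ ((dev_iteratedCommutator hα hβ j).trans_lt h2)⟩
    have p1 : 0 ≤ (1 / 4 : ℝ) ^ j * ‖α 0‖ := by positivity
    linarith [norm_iteratedCommutator hα hβ j]
  have descend : ∀ j, Commute (lin α) (lin (iteratedCommutator α β j)) →
      Commute (lin α) (lin β) := by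
    intro j
    induction j with
    | zero => exact id
    | succ j ih =>
      intro hc
      refine ih (commute_of_commute_commutator ?_ ?_)
      · have : (1 / 4 : ℝ) ^ j ≤ 1 := pow_le_one₀ (by norm_num) (by norm_num)
        linarith [dev_iteratedCommutator hα hβ j]
      · simpa only [iteratedCommutator, map_mul, map_inv] using hc
  refine descend j ?_
  rw [hj, map_one]
  exact Commute.one_right _

/-- Finitely many rotation parts approximate all rotation parts. -/
lemma exists_finite_reps (Γ : Subgroup (Isom n)) {δ : ℝ} (hδ : 0 < δ) :
    ∃ s : Set (Isom n), s.Finite ∧ s ⊆ Γ ∧ ∀ γ ∈ Γ, ∃ σ ∈ s, dev (lin (γ * σ⁻¹)) ≤ δ := by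
  -- Inverses are taken so that closeness controls the right quotient γσ⁻¹. The values lie in the
  -- compact unit ball of operators.
  let f : Isom n → (E n →L[ℝ] E n) := fun γ => toCLM (lin γ)⁻¹
  have hb : TotallyBounded (f '' Γ) := by
    refine TotallyBounded.subset ?_ (isCompact_closedBall (0 : E n →L[ℝ] E n) 1).totallyBounded
    rintro _ ⟨γ, -, rfl⟩
    rw [mem_closedBall_zero_iff]
    refine ContinuousLinearMap.opNorm_le_bound _ zero_le_one fun x => ?_
    rw [toCLM_apply, LinearIsometryEquiv.norm_map, one_mul]
  obtain ⟨t, hts, htf, hcov⟩ := Metric.finite_approx_of_totallyBounded hb δ hδ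
  obtain ⟨s, hsΓ, hsb⟩ := Set.surjOn_iff_exists_bijOn_subset.1 (show Set.SurjOn f Γ t from hts)
  refine ⟨s, Set.Finite.of_finite_image (hsb.image_eq ▸ htf) hsb.injOn, hsΓ, fun γ hγ => ?_⟩
  obtain ⟨c, hc, hd⟩ := Set.mem_iUnion₂.1 (hcov ⟨γ, hγ, rfl⟩)
  obtain ⟨σ, hσ, rfl⟩ := hsb.surjOn hc
  refine ⟨σ, hσ, ?_⟩
  have h1 := dev_inv_mul (lin γ)⁻¹ (lin σ)⁻¹
  rw [inv_inv, ← map_inv lin σ, ← map_mul] at h1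
  refine h1.trans ?_
  rw [map_inv, ← dist_eq_norm]
  exact (Metric.mem_ball.1 hd).le

/-- The translation vectors of a group of isometries. -/
def translations (G : Subgroup (Isom n)) : AddSubgroup (E n) where
  carrier := {a | ∃ γ ∈ G, lin γ = 1 ∧ γ 0 = a}
  zero_mem' := ⟨1, G.one_mem, map_one _, rfl⟩
  add_mem' := by
    rintro _ _ ⟨γ, hγ, hl, rfl⟩ ⟨γ', hγ', hl', rfl⟩
    refine ⟨γ * γ', G.mul_mem hγ hγ', by rw [map_mul, hl, hl', one_mul], ?_⟩
    rw [isom_mul_zero, hl]; rfl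
  neg_mem' := by
    rintro _ ⟨γ, hγ, hl, rfl⟩
    refine ⟨γ⁻¹, G.inv_mem hγ, by rw [map_inv, hl, inv_one], ?_⟩
    rw [isom_inv_zero, map_inv, hl, inv_one]; rfl

lemma lin_mem_translations {G : Subgroup (Isom n)} {γ : Isom n} (hγ : γ ∈ G) {a : E n}
    (ha : a ∈ translations G) : lin γ a ∈ translations G := by
  obtain ⟨τ, hτ, hl, rfl⟩ := ha
  refine ⟨γ * τ * γ⁻¹, G.mul_mem (G.mul_mem hγ hτ) (G.inv_mem hγ), ?_, ?_⟩
  · rw [map_mul, map_mul, hl, mul_one, map_inv, mul_inv_cancel]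
  · rw [isom_mul_zero, isom_mul_zero, map_mul, hl, mul_one, isom_inv_zero, map_neg, map_inv,
      apply_inv_self']
    abel

lemma discreteTopology_translations {G : Subgroup (Isom n)}
    (h : IsDiscrete (G : Set (Isom n))) : DiscreteTopology (translations G) := by
  obtain ⟨ε, hε, hiso⟩ := exists_isolating h
  refine discreteTopology_of_isOpen_singleton_zero ?_
  rw [Metric.isOpen_singleton_iff]
  refine ⟨ε, hε, fun ⟨a, γ, hγ, hl, h0⟩ hd => ?_⟩
  subst h0
  rw [dist_zero_right] at hd
  have h1 : γ = 1 := by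
    refine hiso γ hγ hd ?_
    rw [hl]
    have : dev (1 : E n ≃ₗᵢ[ℝ] E n) = 0 := le_antisymm (dev_le le_rfl (by simp)) (dev_nonneg _)
    rwa [this]
  subst h1
  rfl

lemma finite_translations {G : Subgroup (Isom n)} (h : IsDiscrete (G : Set (Isom n))) (r : ℝ) :
    {a : E n | a ∈ translations G ∧ ‖a‖ ≤ r}.Finite := by
  have := discreteTopology_translations h
  have hc : IsClosed (translations G : Set (E n)) := AddSubgroup.isClosed_of_discrete
  refine (Metric.finite_isBounded_inter_isClosed (s := (translations G : Set (E n))) ⟨this⟩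
    (Metric.isBounded_closedBall (x := (0 : E n)) (r := r)) hc).subset ?_
  exact fun a ha => ⟨by simpa using ha.2, ha.1⟩

/-- If the rotation parts of a cocompact group of isometries commute, then they act trivially
modulo the span of the translations. -/
lemma apply_sub_mem_span {G : Subgroup (Isom n)}
    (hcomm : ∀ α ∈ G, ∀ β ∈ G, Commute (lin α) (lin β)) {R : ℝ}
    (hR : ∀ x : E n, ∃ γ ∈ G, ‖x - γ 0‖ ≤ R) {α : Isom n} (hα : α ∈ G) (x : E n) :
    lin α x - x ∈ Submodule.span ℝ (translations G : Set (E n)) := by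
  set V := Submodule.span ℝ (translations G : Set (E n)) with hV
  let f : E n →ₗ[ℝ] E n := (Vᗮ.starProjection.toLinearMap).comp
    ((lin α).toLinearEquiv.toLinearMap - LinearMap.id)
  have hf : ∀ x, f x = Vᗮ.starProjection (lin α x - x) := fun _ => rfl
  -- [α, β] is a translation, by (Aβ0 − β0) − (Bα0 − α0). Modulo V this bounds (A − 1)β0
  -- independently of β; the points β0 are coarsely dense, so the linear map is bounded and
  -- therefore zero.
  have key : ∀ β ∈ G, ‖f (β 0)‖ ≤ 2 * ‖α 0‖ := by
    intro β hβ
    have hk : (lin α (β 0) - β 0) - (lin β (α 0) - α 0) ∈ V := by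
      refine Submodule.subset_span ⟨α * β * α⁻¹ * β⁻¹, ?_, ?_, ?_⟩
      · exact G.mul_mem (G.mul_mem (G.mul_mem hα hβ) (G.inv_mem hα)) (G.inv_mem hβ)
      · rw [map_mul, map_mul, map_mul, (hcomm α hα β hβ).eq, map_inv, map_inv]; group
      · set κ := α * β * α⁻¹ * β⁻¹ with hκ
        have hl : lin κ = 1 := by
          rw [hκ, map_mul, map_mul, map_mul, (hcomm α hα β hβ).eq, map_inv, map_inv]; group
        have h1 : α * β = κ * (β * α) := by rw [hκ]; group
        have h2 := congrArg (fun g : Isom n => g 0) h1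
        simp only [isom_mul_zero, hl, LinearIsometryEquiv.coe_one, id_eq] at h2
        rw [← sub_eq_zero] at h2
        refine sub_eq_zero.1 (neg_eq_zero.1 (Eq.trans ?_ h2))
        abel
    have h0 : Vᗮ.starProjection ((lin α (β 0) - β 0) - (lin β (α 0) - α 0)) = 0 := by
      rw [Submodule.starProjection_apply_eq_zero_iff]
      exact Submodule.le_orthogonal_orthogonal V hk
    rw [map_sub, sub_eq_zero] at h0
    rw [hf, h0]
    refine (Submodule.norm_starProjection_apply_le _ _).trans ?_
    have := norm_sub_le (lin β (α 0)) (α 0)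
    rw [LinearIsometryEquiv.norm_map] at this
    linarith
  have hzero : f = 0 := by
    refine eq_zero_of_forall_norm_le f (2 * ‖α 0‖ + 2 * R) fun y => ?_
    obtain ⟨β, hβ, hd⟩ := hR y
    have e : f y = f (β 0) + f (y - β 0) := by rw [← map_add]; congr 1; abel
    have h1 : ‖f (y - β 0)‖ ≤ 2 * ‖y - β 0‖ := by
      rw [hf]
      refine (Submodule.norm_starProjection_apply_le _ _).trans ?_
      have := norm_sub_le (lin α (y - β 0)) (y - β 0)
      rw [LinearIsometryEquiv.norm_map] at this
      linarith
    rw [e]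
    linarith [norm_add_le (f (β 0)) (f (y - β 0)), key β hβ]
  have h2 : Vᗮ.starProjection (lin α x - x) = 0 := by rw [← hf, hzero]; rfl
  rwa [Submodule.starProjection_apply_eq_zero_iff, Submodule.orthogonal_orthogonal] at h2

/-- Pythagoras for Ay = (Ay − y) + y, combined with ‖Ay‖ = ‖y‖. -/
lemma eq_of_apply_sub_mem {V : Submodule ℝ (E n)} {A : E n ≃ₗᵢ[ℝ] E n}
    (h : ∀ x, A x - x ∈ V) {y : E n} (hy : y ∈ Vᗮ) : A y = y := by
  have h1 : inner ℝ (A y - y) y = 0 := hy _ (h y)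
  have h2 : ‖(A y - y) + y‖ * ‖(A y - y) + y‖ = ‖A y - y‖ * ‖A y - y‖ + ‖y‖ * ‖y‖ :=
    norm_add_sq_eq_norm_sq_add_norm_sq_of_inner_eq_zero _ _ h1
  rw [sub_add_cancel, LinearIsometryEquiv.norm_map, right_eq_add, mul_self_eq_zero,
    norm_eq_zero] at h2
  exact sub_eq_zero.1 h2

/-- A linear part is trivial orthogonally to the translations, and sends each vector of a basis of
their span to one of the finitely many translation vectors of bounded length. -/
lemma finite_lin_of_commute {G : Subgroup (Isom n)} (h : IsDiscrete (G : Set (Isom n)))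
    (hcomm : ∀ α ∈ G, ∀ β ∈ G, Commute (lin α) (lin β)) {R : ℝ}
    (hR : ∀ x : E n, ∃ γ ∈ G, ‖x - γ 0‖ ≤ R) : (lin '' (G : Set (Isom n))).Finite := by
  obtain ⟨b, hbL, hbs, hbi⟩ := exists_linearIndependent ℝ (translations G : Set (E n))
  have hbf : Finite b := hbi.setFinite
  let f : (E n ≃ₗᵢ[ℝ] E n) → (b → E n) := fun A i => A i
  refine Set.Finite.of_injOn (f := f)
    (t := Set.pi Set.univ fun i : b => {a : E n | a ∈ translations G ∧ ‖a‖ ≤ ‖(i : E n)‖}) ?_ ?_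
    (Set.Finite.pi fun i => finite_translations h _)
  · rintro _ ⟨γ, hγ, rfl⟩ i -
    exact ⟨lin_mem_translations hγ (hbL i.2), (LinearIsometryEquiv.norm_map _ _).le⟩
  · rintro _ ⟨α, hα, rfl⟩ _ ⟨β, hβ, rfl⟩ hab
    have hV : ∀ v ∈ Submodule.span ℝ (translations G : Set (E n)), lin α v = lin β v := by
      rw [← hbs]
      intro v hv
      induction hv using Submodule.span_induction with
      | mem x hx => exact congrFun hab ⟨x, hx⟩
      | zero => simp
      | add x y _ _ hx hy => rw [map_add, map_add, hx, hy]
      | smul c x _ hx => rw [map_smul, map_smul, hx]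
    ext1 x
    obtain ⟨v, hv, w, hw, rfl⟩ :=
      (Submodule.span ℝ (translations G : Set (E n))).exists_add_mem_mem_orthogonal x
    rw [map_add, map_add, hV v hv, eq_of_apply_sub_mem (apply_sub_mem_span hcomm hR hα) hw,
      eq_of_apply_sub_mem (apply_sub_mem_span hcomm hR hβ) hw]

/-- Replacing γ by γσ⁻¹ moves the orbit point by ‖σ 0‖, which is bounded on the finite set of
representatives. -/
lemma covering_radius_of_reps {Γ : Subgroup (Isom n)} {P : Isom n → Prop} {R : ℝ}
    (hR : ∀ x : E n, ∃ γ ∈ Γ, ‖x - γ 0‖ ≤ R) {s : Set (Isom n)} (hs : s.Finite)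
    (h : ∀ γ ∈ Γ, ∃ σ ∈ s, P (γ * σ⁻¹)) : ∃ R' : ℝ, ∀ x : E n, ∃ γ, P γ ∧ ‖x - γ 0‖ ≤ R' := by
  obtain ⟨C, hC⟩ := (hs.image fun σ : Isom n => ‖σ 0‖).bddAbove
  refine ⟨R + C, fun x => ?_⟩
  obtain ⟨γ, hγ, hx⟩ := hR x
  obtain ⟨σ, hσ, hP⟩ := h γ hγ
  refine ⟨γ * σ⁻¹, hP, ?_⟩
  have h1 : ‖γ 0 - (γ * σ⁻¹) 0‖ ≤ C := by
    have e : γ 0 = (γ * σ⁻¹) (σ 0) := by rw [isom_mul_apply, isom_inv_apply_self]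
    rw [e, norm_isom_sub, sub_zero]
    exact hC ⟨σ, hσ, rfl⟩
  have e : x - (γ * σ⁻¹) 0 = (x - γ 0) + (γ 0 - (γ * σ⁻¹) 0) := by abel
  rw [e]
  exact (norm_add_le _ _).trans (add_le_add hx h1)

/-- Bieberbach's first theorem: the point group of a space group is finite. -/
theorem IsSpaceGroup.finite_lin {Γ : Subgroup (Isom n)} (h : IsSpaceGroup Γ) :
    (lin '' (Γ : Set (Isom n))).Finite := by
  -- Elements with small rotation parts have commuting rotation parts, and so does the group they
  -- generate. Finitely many right cosets of it cover Γ, so it is still coarsely dense.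
  let S : Set (Isom n) := {γ | γ ∈ Γ ∧ dev (lin γ) ≤ 1 / 8}
  let G := Subgroup.closure S
  have hGΓ : G ≤ Γ := (Subgroup.closure_le _).2 fun γ hγ => hγ.1
  have hcomm : ∀ α ∈ G, ∀ β ∈ G, Commute (lin α) (lin β) := by
    have h1 : ∀ α ∈ S, ∀ β ∈ G, Commute (lin α) (lin β) := by
      intro α hα β hβ
      induction hβ using Subgroup.closure_induction with
      | mem β hβ => exact commute_lin_of_dev_le h.discrete hα.1 hβ.1 hα.2 hβ.2
      | one => rw [map_one]; exact Commute.one_right _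
      | mul x y _ _ hx hy => rw [map_mul]; exact hx.mul_right hy
      | inv x _ hx => rw [map_inv]; exact hx.inv_right
    intro α hα β hβ
    induction hα using Subgroup.closure_induction with
    | mem α hα => exact h1 α hα β hβ
    | one => rw [map_one]; exact Commute.one_left _
    | mul x y _ _ hx hy => rw [map_mul]; exact hx.mul_left hy
    | inv x _ hx => rw [map_inv]; exact hx.inv_left
  obtain ⟨s, hsf, hsΓ, hs⟩ := exists_finite_reps Γ (δ := 1 / 8) (by norm_num)
  have hs' : ∀ γ ∈ Γ, ∃ σ ∈ s, γ * σ⁻¹ ∈ G := by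
    intro γ hγ
    obtain ⟨σ, hσ, hd⟩ := hs γ hγ
    exact ⟨σ, hσ, Subgroup.subset_closure ⟨Γ.mul_mem hγ (Γ.inv_mem (hsΓ hσ)), hd⟩⟩
  obtain ⟨R, hR⟩ := exists_covering_radius h.cocompact
  obtain ⟨R', hR'⟩ := covering_radius_of_reps hR hsf hs'
  have hfin := finite_lin_of_commute (h.discrete.mono hGΓ) hcomm hR'
  refine (Set.Finite.image2 (fun A B => A * B) hfin (hsf.image lin)).subset ?_
  rintro _ ⟨γ, hγ, rfl⟩
  obtain ⟨σ, hσ, hG⟩ := hs' γ hγ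
  exact ⟨_, ⟨_, hG, rfl⟩, _, ⟨σ, hσ, rfl⟩, by
    change lin _ * lin _ = _
    rw [← map_mul, inv_mul_cancel_right]⟩

lemma IsSpaceGroup.exists_translations_covering {Γ : Subgroup (Isom n)} (h : IsSpaceGroup Γ) :
    ∃ R : ℝ, ∀ x : E n, ∃ a ∈ translations Γ, ‖x - a‖ ≤ R := by
  obtain ⟨R, hR⟩ := exists_covering_radius h.cocompact
  obtain ⟨s, hsΓ, hsb⟩ := Set.exists_subset_bijOn (Γ : Set (Isom n)) lin
  have hsf : s.Finite := Set.Finite.of_finite_image (hsb.image_eq ▸ h.finite_lin) hsb.injOn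
  obtain ⟨R', hR'⟩ := covering_radius_of_reps (P := fun γ => γ ∈ Γ ∧ lin γ = 1) hR hsf (by
    intro γ hγ
    obtain ⟨σ, hσ, hl⟩ := hsb.surjOn ⟨γ, hγ, rfl⟩
    exact ⟨σ, hσ, Γ.mul_mem hγ (Γ.inv_mem (hsΓ hσ)), by rw [map_mul, map_inv, hl, mul_inv_cancel]⟩)
  refine ⟨R', fun x => ?_⟩
  obtain ⟨γ, ⟨hγ, hl⟩, hx⟩ := hR' x
  exact ⟨γ 0, ⟨γ, hγ, hl, rfl⟩, hx⟩

lemma IsSpaceGroup.span_translations {Γ : Subgroup (Isom n)} (h : IsSpaceGroup Γ) :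
    Submodule.span ℝ (translations Γ : Set (E n)) = ⊤ := by
  set V := Submodule.span ℝ (translations Γ : Set (E n)) with hV
  obtain ⟨R, hR⟩ := h.exists_translations_covering
  have h0 : Vᗮ.starProjection.toLinearMap = 0 := by
    refine eq_zero_of_forall_norm_le _ R fun x => ?_
    obtain ⟨a, ha, hx⟩ := hR x
    have h1 : Vᗮ.starProjection a = 0 := by
      rw [Submodule.starProjection_apply_eq_zero_iff]
      exact Submodule.le_orthogonal_orthogonal V (Submodule.subset_span ha)
    have h2 : Vᗮ.starProjection x = Vᗮ.starProjection (x - a) := by rw [map_sub, h1, sub_zero]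
    change ‖Vᗮ.starProjection x‖ ≤ R
    rw [h2]
    exact (Submodule.norm_starProjection_apply_le _ _).trans hx
  refine eq_top_iff.2 fun x _ => ?_
  have h2 : Vᗮ.starProjection x = 0 := LinearMap.congr_fun h0 x
  rwa [Submodule.starProjection_apply_eq_zero_iff, Submodule.orthogonal_orthogonal] at h2

end Bieberbach


/-! ### Powers acting as inner automorphisms -/

section FiniteOrder

/-- If a group has a normal abelian subgroup of finite index, then every element has a power that
acts on a given normal subgroup as an inner automorphism of that subgroup. -/
lemma exists_pow_conj_eq {Γ : Type*} [Group Γ] (T N : Subgroup Γ) [T.Normal] [N.Normal]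
    [T.FiniteIndex] (hT : ∀ a ∈ T, ∀ b ∈ T, a * b = b * a) (γ : Γ) :
    ∃ k : ℕ, 0 < k ∧ ∃ p ∈ N, ∀ ν ∈ N, γ ^ k * ν * (γ ^ k)⁻¹ = p * ν * p⁻¹ := by
  classical
  set τ := γ ^ T.index with hτ
  have hτT : τ ∈ T := T.pow_index_mem γ
  let L : Subgroup Γ := T ⊓ N
  let _ : CommGroup L :=
    { (inferInstance : Group L) with
      mul_comm := fun a b => Subtype.ext (hT a a.2.1 b b.2.1) }
  -- The crossed homomorphism ν ↦ [τ, ν]. It is constant on left cosets of T ∩ N because τ commutes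
  -- with T.
  let d : N → L := fun ν => ⟨τ * ν * τ⁻¹ * (ν : Γ)⁻¹, by
    constructor
    · have h1 := (inferInstance : T.Normal).conj_mem _ (T.inv_mem hτT) ν
      have e : τ * ν * τ⁻¹ * (ν : Γ)⁻¹ = τ * (ν * τ⁻¹ * (ν : Γ)⁻¹) := by group
      rw [e]
      exact T.mul_mem hτT h1
    · exact N.mul_mem ((inferInstance : N.Normal).conj_mem _ ν.2 τ) (N.inv_mem ν.2)⟩
  have hd : ∀ ν : N, τ * ν * τ⁻¹ = d ν * ν := fun ν => by simp [d]
  have hinv : ∀ ν l : N, (l : Γ) ∈ T → d (ν * l) = d ν := by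
    intro ν l hl
    refine Subtype.ext ?_
    have h1 := hT _ hτT _ hl
    change τ * ((ν : Γ) * l) * τ⁻¹ * ((ν : Γ) * l)⁻¹ = τ * ν * τ⁻¹ * (ν : Γ)⁻¹
    have h2 : τ * ((ν : Γ) * l) * τ⁻¹ = τ * ν * τ⁻¹ * l := by
      have : (l : Γ) * τ⁻¹ = τ⁻¹ * l := by
        rw [mul_inv_eq_iff_eq_mul, mul_assoc, ← h1]; group
      rw [mul_assoc, mul_assoc (ν : Γ), this]; group
    rw [h2]; group
  have hcoc : ∀ ν μ : N, d (ν * μ) = d ν * MulAut.conjNormal (ν : Γ) (d μ) := by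
    intro ν μ
    refine Subtype.ext ?_
    rw [Subgroup.coe_mul, MulAut.conjNormal_apply]
    simp only [d, Subgroup.coe_mul]
    group
  let H : Subgroup N := T.subgroupOf N
  let q : N ⧸ H → L := Quotient.lift d (by
    intro a b hab
    have h1 : a⁻¹ * b ∈ H := QuotientGroup.leftRel_apply.1 hab
    have h2 := hinv a (a⁻¹ * b) h1
    rw [mul_inv_cancel_left] at h2
    exact h2.symm)
  have hq : ∀ ν : N, q (QuotientGroup.mk ν) = d ν := fun _ => rfl
  let _ : Fintype (N ⧸ H) := Fintype.ofFinite _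
  -- Multiplying the cocycle identity over all cosets gives P = d(ν)^k · νPν⁻¹ with k the number of
  -- cosets. Since τ^k ν τ^{−k} = d(ν)^k ν, this is PνP⁻¹.
  set P : L := ∏ x, q x with hP
  have hprod : ∀ ν : N, P = d ν ^ Fintype.card (N ⧸ H) * MulAut.conjNormal (ν : Γ) P := by
    intro ν
    calc P = ∏ x : N ⧸ H, q (ν • x) := (Equiv.prod_comp (MulAction.toPerm ν) q).symm
      _ = ∏ x : N ⧸ H, d ν * MulAut.conjNormal (ν : Γ) (q x) := by
        refine Finset.prod_congr rfl fun x _ => ?_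
        induction x using QuotientGroup.induction_on with
        | H μ => exact hcoc ν μ
      _ = _ := by
        rw [Finset.prod_mul_distrib, Finset.prod_const, Finset.card_univ, ← map_prod]
  have hpow : ∀ (ν : N) (j : ℕ), τ ^ j * ν * (τ ^ j)⁻¹ = (d ν : Γ) ^ j * ν := by
    intro ν j
    induction j with
    | zero => simp
    | succ j ih =>
      have hc : Commute τ ((d ν : Γ) ^ j) := Commute.pow_right (hT _ hτT _ (d ν).2.1) j
      calc τ ^ (j + 1) * ν * (τ ^ (j + 1))⁻¹ = τ * (τ ^ j * ν * (τ ^ j)⁻¹) * τ⁻¹ := by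
            rw [pow_succ']; group
        _ = (τ * (d ν : Γ) ^ j) * ν * τ⁻¹ := by rw [ih]; group
        _ = (d ν : Γ) ^ j * (τ * ν * τ⁻¹) := by rw [hc.eq]; group
        _ = (d ν : Γ) ^ (j + 1) * ν := by rw [hd, pow_succ]; group
  refine ⟨T.index * Fintype.card (N ⧸ H), Nat.mul_pos (Nat.pos_of_ne_zero
    Subgroup.FiniteIndex.index_ne_zero) Fintype.card_pos, P, P.2.2, fun ν hν => ?_⟩
  rw [pow_mul, ← hτ, hpow ⟨ν, hν⟩]
  have h1 := congrArg (Subtype.val : L → Γ) (hprod ⟨ν, hν⟩)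
  rw [Subgroup.coe_mul, MulAut.conjNormal_apply, Subgroup.coe_pow] at h1
  rw [eq_mul_inv_iff_mul_eq]
  conv_rhs => rw [h1]
  group

end FiniteOrder

/-! ### The outer class as a complete invariant of extensions by ℤ -/

section OuterClass

variable {Γ M : Type} [Group Γ] [Group M] {N : Subgroup Γ} [N.Normal]

/-- The outer class as a group homomorphism. -/
def outHom (α : N ≃* M) : Γ →* Out M :=
  (QuotientGroup.mk' (Inn M)).comp ((MulAut.congr α).toMonoidHom.comp MulAut.conjNormal)

lemma outHom_apply (α : N ≃* M) (γ : Γ) : outHom α γ = outClass α γ := rfl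

lemma outClass_inv (α : N ≃* M) (γ : Γ) : outClass α γ⁻¹ = (outClass α γ)⁻¹ :=
  map_inv (outHom α) γ

lemma congr_conjNormal_apply (α : N ≃* M) (γ : Γ) (μ : M) :
    MulAut.congr α (MulAut.conjNormal γ) μ = α (MulAut.conjNormal γ (α.symm μ)) := rfl

lemma congr_conjNormal_coe (α : N ≃* M) (ν : N) :
    MulAut.congr α (MulAut.conjNormal (ν : Γ)) = MulAut.conj (α ν) := by
  ext μ
  rw [congr_conjNormal_apply, MulAut.conj_apply]
  have : MulAut.conjNormal (ν : Γ) (α.symm μ) = ν * α.symm μ * ν⁻¹ := Subtype.ext (by simp)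
  rw [this, map_mul, map_mul, map_inv, MulEquiv.apply_symm_apply]

lemma outClass_coe (α : N ≃* M) (ν : N) : outClass α (ν : Γ) = 1 := by
  rw [outClass, congr_conjNormal_coe, QuotientGroup.eq_one_iff]
  exact ⟨α ν, rfl⟩

lemma outClass_eq_of_mk_eq (α : N ≃* M) {γ γ' : Γ}
    (h : (QuotientGroup.mk γ : Γ ⧸ N) = QuotientGroup.mk γ') : outClass α γ = outClass α γ' := by
  have h1 : γ⁻¹ * γ' ∈ N := QuotientGroup.eq.1 h
  have h2 := outClass_coe α ⟨_, h1⟩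
  rw [← outHom_apply, map_mul, map_inv, inv_mul_eq_one] at h2
  exact h2

lemma isOfFinOrder_outClass (α : N ≃* M) (T : Subgroup Γ) [T.Normal] [T.FiniteIndex]
    (hT : ∀ a ∈ T, ∀ b ∈ T, a * b = b * a) (γ : Γ) : IsOfFinOrder (outClass α γ) := by
  obtain ⟨k, hk, p, hp, h⟩ := exists_pow_conj_eq T N hT γ
  refine isOfFinOrder_iff_pow_eq_one.2 ⟨k, hk, ?_⟩
  rw [← outHom_apply, ← map_pow, outHom_apply, ← outClass_coe α ⟨p, hp⟩, outClass, outClass]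
  congr 2
  ext ν
  rw [MulAut.conjNormal_apply, MulAut.conjNormal_apply]
  exact h ν ν.2

lemma outClass_trans (α : N ≃* M) (a : MulAut M) (γ : Γ) :
    outClass (α.trans a) γ
      = (QuotientGroup.mk a : Out M) * outClass α γ * (QuotientGroup.mk a : Out M)⁻¹ := rfl

lemma exists_outClass_map {Γ' : Type} [Group Γ'] {N' : Subgroup Γ'} [N'.Normal] (φ : Γ ≃* Γ')
    (h : N.map φ.toMonoidHom = N') (α : N ≃* M) (β : N' ≃* M) :
    ∃ g : Out M, ∀ γ, outClass β (φ γ) = g * outClass α γ * g⁻¹ := by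
  subst h
  let r : N ≃* N.map φ.toMonoidHom := φ.subgroupMap N
  refine ⟨QuotientGroup.mk (α.symm.trans (r.trans β)), fun γ => ?_⟩
  rw [← outClass_trans, outClass, outClass]
  congr 1
  ext μ
  rw [congr_conjNormal_apply, congr_conjNormal_apply]
  have e : α.trans (α.symm.trans (r.trans β)) = r.trans β := by ext x; simp
  rw [e]
  change β _ = β (r _)
  congr 1
  refine Subtype.ext ?_
  have h1 : ∀ x : N, (r x : Γ') = φ x := fun _ => rfl
  rw [h1, MulAut.conjNormal_apply, MulAut.conjNormal_apply, map_mul, map_mul, map_inv, ← h1]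
  congr 3
  exact (r.apply_symm_apply (β.symm μ)).symm

lemma pairClass_conj {G : Type} [Group G] (g x : G) :
    pairClass (g * x * g⁻¹) (g * x * g⁻¹)⁻¹ = pairClass x x⁻¹ := by
  refine (Quotient.sound ?_).symm
  refine ⟨g, ?_⟩
  simp [mul_assoc]

lemma pairClass_inv {G : Type} [Group G] (x : G) : pairClass x⁻¹ x⁻¹⁻¹ = pairClass x x⁻¹ := by
  rw [inv_inv, pairClass, pairClass, Sym2.eq_swap]

lemma pairClass_eq_iff {G : Type} [Group G] {x y : G} (h : pairClass x x⁻¹ = pairClass y y⁻¹) :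
    ∃ g : G, g * x * g⁻¹ = y ∨ g * x * g⁻¹ = y⁻¹ := by
  obtain ⟨g, hg⟩ := Quotient.exact h
  refine ⟨g, ?_⟩
  rw [Sym2.map_mk, Sym2.eq_iff] at hg
  rcases hg with hg | hg
  · exact Or.inl hg.1
  · exact Or.inr hg.1

lemma eq_or_eq_inv_of_zpowers_eq_top {G : Type*} [Group G] [Infinite G] {a b : G}
    (ha : Subgroup.zpowers a = ⊤) (hb : Subgroup.zpowers b = ⊤) : b = a ∨ b = a⁻¹ := by
  obtain ⟨i, hi⟩ : b ∈ Subgroup.zpowers a := ha ▸ Subgroup.mem_top b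
  obtain ⟨j, hj⟩ : a ∈ Subgroup.zpowers b := hb ▸ Subgroup.mem_top a
  have ho : orderOf a = 0 := Infinite.orderOf_eq_zero_of_forall_mem_zpowers
    (fun x => ha ▸ Subgroup.mem_top x)
  have hinj : Function.Injective fun k : ℤ => a ^ k := injective_zpow_iff_not_isOfFinOrder.2
    (orderOf_eq_zero_iff.1 ho)
  have h1 : i * j = 1 := hinj (by
    change a ^ (i * j) = a ^ (1 : ℤ)
    rw [zpow_mul, zpow_one]
    simp only at hi hj
    rw [hi, hj])
  simp only at hi
  rcases Int.eq_one_or_neg_one_of_mul_eq_one h1 with h | h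
  · left; rw [← hi, h, zpow_one]
  · right; rw [← hi, h, zpow_neg, zpow_one]

lemma zpowers_mk_map {Γ' : Type} [Group Γ'] {N' : Subgroup Γ'} [N'.Normal] (φ : Γ ≃* Γ')
    (h : N.map φ.toMonoidHom = N') {γ : Γ}
    (hγ : Subgroup.zpowers (QuotientGroup.mk γ : Γ ⧸ N) = ⊤) :
    Subgroup.zpowers (QuotientGroup.mk (φ γ) : Γ' ⧸ N') = ⊤ := by
  let f : Γ ⧸ N →* Γ' ⧸ N' := QuotientGroup.map N N' φ.toMonoidHom
    (Subgroup.map_le_iff_le_comap.1 h.le)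
  have hf : Function.Surjective f := fun y => by
    obtain ⟨y, rfl⟩ := QuotientGroup.mk_surjective y
    exact ⟨QuotientGroup.mk (φ.symm y), congrArg QuotientGroup.mk (φ.apply_symm_apply y)⟩
  have h1 := congrArg (Subgroup.map f) hγ
  rw [MonoidHom.map_zpowers, Subgroup.map_top_of_surjective _ hf] at h1
  exact h1

lemma zpowers_mk_inv {γ : Γ} (hγ : Subgroup.zpowers (QuotientGroup.mk γ : Γ ⧸ N) = ⊤) :
    Subgroup.zpowers (QuotientGroup.mk γ⁻¹ : Γ ⧸ N) = ⊤ := by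
  rw [QuotientGroup.mk_inv, Subgroup.zpowers_inv, hγ]

/-- The conjugacy class of the pair of inverse outer automorphisms is an isomorphism invariant of
the pair and does not depend on the choices. -/
lemma pairClass_eq_of_map {Γ' : Type} [Group Γ'] {N' : Subgroup Γ'} [N'.Normal] (φ : Γ ≃* Γ')
    (h : N.map φ.toMonoidHom = N') (α : N ≃* M) (β : N' ≃* M) [Infinite (Γ' ⧸ N')]
    {γ : Γ} (hγ : Subgroup.zpowers (QuotientGroup.mk γ : Γ ⧸ N) = ⊤)
    {γ' : Γ'} (hγ' : Subgroup.zpowers (QuotientGroup.mk γ' : Γ' ⧸ N') = ⊤) :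
    pairClass (outClass α γ) (outClass α γ)⁻¹ = pairClass (outClass β γ') (outClass β γ')⁻¹ := by
  obtain ⟨g, hg⟩ := exists_outClass_map φ h α β
  rw [← pairClass_conj g (outClass α γ), ← hg]
  -- An infinite cyclic group has only two generators, and inverting the generator just swaps the
  -- unordered pair.
  rcases eq_or_eq_inv_of_zpowers_eq_top (zpowers_mk_map φ h hγ) hγ' with h1 | h1
  · rw [outClass_eq_of_mk_eq β h1]
  · rw [← QuotientGroup.mk_inv] at h1
    rw [outClass_eq_of_mk_eq β h1, outClass_inv, pairClass_inv]

/-- An extension of an infinite cyclic group is a semidirect product. -/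
lemma exists_semidirectProduct_equiv [Infinite (Γ ⧸ N)] (α : N ≃* M) {γ : Γ}
    (hγ : Subgroup.zpowers (QuotientGroup.mk γ : Γ ⧸ N) = ⊤) {ψ : MulAut M}
    (hψ : MulAut.congr α (MulAut.conjNormal γ) = ψ) :
    ∃ e : M ⋊[zpowersHom (MulAut M) ψ] Multiplicative ℤ ≃* Γ,
      ∀ μ, e (SemidirectProduct.inl μ) = α.symm μ := by
  subst hψ
  set ψ := MulAut.congr α (MulAut.conjNormal γ) with hψ
  let f : M ⋊[zpowersHom (MulAut M) ψ] Multiplicative ℤ →* Γ :=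
    SemidirectProduct.lift (N.subtype.comp α.symm.toMonoidHom) (zpowersHom Γ γ) (by
      intro i
      ext μ
      have h1 : zpowersHom (MulAut M) ψ i
          = MulAut.congr α (MulAut.conjNormal (γ ^ (Multiplicative.toAdd i))) := by
        rw [zpowersHom_apply, map_zpow, map_zpow]
      simp only [MonoidHom.comp_apply, MulEquiv.coe_toMonoidHom, h1, congr_conjNormal_apply,
        MulEquiv.symm_apply_apply, Subgroup.coe_subtype, MulAut.conj_apply, zpowersHom_apply,
        MulAut.conjNormal_apply])
  have hf : ∀ x, f x = (α.symm x.left : Γ) * γ ^ (Multiplicative.toAdd x.right) := fun _ => rfl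
  have ho : orderOf (QuotientGroup.mk γ : Γ ⧸ N) = 0 :=
    Infinite.orderOf_eq_zero_of_forall_mem_zpowers fun x => hγ ▸ Subgroup.mem_top x
  have hinj : Function.Injective f := by
    refine (injective_iff_map_eq_one f).2 fun x hx => ?_
    rw [hf] at hx
    have h1 := congrArg (QuotientGroup.mk : Γ → Γ ⧸ N) hx
    have h2 : (QuotientGroup.mk ((α.symm x.left : N) : Γ) : Γ ⧸ N) = 1 :=
      (QuotientGroup.eq_one_iff _).2 (α.symm x.left).2
    rw [QuotientGroup.mk_mul, h2, one_mul, QuotientGroup.mk_zpow, QuotientGroup.mk_one] at h1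
    have h3 : Multiplicative.toAdd x.right = 0 := by
      have := orderOf_dvd_iff_zpow_eq_one.2 h1
      rw [ho] at this
      simpa using this
    rw [h3, zpow_zero, mul_one] at hx
    refine SemidirectProduct.ext ?_ ?_
    · have : α.symm x.left = 1 := Subtype.ext hx
      simpa using this
    · exact Multiplicative.toAdd.injective h3
  have hsurj : Function.Surjective f := by
    intro g
    obtain ⟨i, hi⟩ : (QuotientGroup.mk g : Γ ⧸ N) ∈ Subgroup.zpowers (QuotientGroup.mk γ : Γ ⧸ N) :=
      hγ ▸ Subgroup.mem_top _
    have h1 : g * (γ ^ i)⁻¹ ∈ N := by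
      rw [← QuotientGroup.eq_one_iff, QuotientGroup.mk_mul, QuotientGroup.mk_inv,
        QuotientGroup.mk_zpow, mul_inv_eq_one]
      exact hi.symm
    refine ⟨⟨α ⟨_, h1⟩, Multiplicative.ofAdd i⟩, ?_⟩
    rw [hf]
    simp
  exact ⟨MulEquiv.ofBijective f ⟨hinj, hsurj⟩, fun μ =>
    (hf (SemidirectProduct.inl μ)).trans (by simp)⟩

/-- Equal outer classes differ by some conj μ, which is absorbed into the lift by replacing γ' with
γ' · β⁻¹(μ). Both groups then become literally the same semidirect product, with matching fibers. -/
lemma exists_equiv_of_conj {Γ' : Type} [Group Γ'] {N' : Subgroup Γ'} [N'.Normal]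
    [Infinite (Γ ⧸ N)] [Infinite (Γ' ⧸ N')] (α : N ≃* M) (β : N' ≃* M)
    {γ : Γ} (hγ : Subgroup.zpowers (QuotientGroup.mk γ : Γ ⧸ N) = ⊤)
    {γ' : Γ'} (hγ' : Subgroup.zpowers (QuotientGroup.mk γ' : Γ' ⧸ N') = ⊤)
    {g : Out M} (hg : g * outClass α γ * g⁻¹ = outClass β γ') :
    ∃ φ : Γ ≃* Γ', N.map φ.toMonoidHom = N' := by
  obtain ⟨a, rfl⟩ := QuotientGroup.mk_surjective g
  rw [← outClass_trans] at hg
  obtain ⟨μ, hμ⟩ : (MulAut.congr β (MulAut.conjNormal γ'))⁻¹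
      * MulAut.congr (α.trans a) (MulAut.conjNormal γ) ∈ Inn M := QuotientGroup.eq.1 hg.symm
  obtain ⟨e, he⟩ := exists_semidirectProduct_equiv (α.trans a) hγ rfl
  have h1 : Subgroup.zpowers (QuotientGroup.mk (γ' * (β.symm μ : N')) : Γ' ⧸ N') = ⊤ := by
    rw [← hγ']
    congr 1
    rw [QuotientGroup.eq]
    simp
  obtain ⟨e', he'⟩ := exists_semidirectProduct_equiv β h1
    (ψ := MulAut.congr (α.trans a) (MulAut.conjNormal γ)) (by
      rw [map_mul, map_mul, congr_conjNormal_coe, MulEquiv.apply_symm_apply, hμ,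
        mul_inv_cancel_left])
  refine ⟨e.symm.trans e', ?_⟩
  have key : ∀ μ, (e.symm.trans e') ((α.trans a).symm μ : N) = (β.symm μ : N') := by
    intro μ
    rw [← he, MulEquiv.trans_apply, MulEquiv.symm_apply_apply, he']
  ext x
  constructor
  · rintro ⟨ν, hν, rfl⟩
    have := key ((α.trans a) ⟨ν, hν⟩)
    rw [MulEquiv.symm_apply_apply] at this
    change (e.symm.trans e') ν ∈ N'
    rw [this]
    exact Subtype.property _
  · intro hx
    refine ⟨((α.trans a).symm (β ⟨x, hx⟩) : N), Subtype.property _, ?_⟩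
    refine (key (β ⟨x, hx⟩)).trans ?_
    rw [MulEquiv.symm_apply_apply]

end OuterClass


/-! ### Fixed conjugators and the transfer of cocycles -/

section Averaging

/-- If a power of an automorphism is inner, then some power is conjugation by a fixed element. -/
lemma exists_fixed_of_pow_eq_conj {M : Type*} [Group M] (φ : MulAut M) {k : ℕ} (hk : 0 < k)
    {μ : M} (h : φ ^ k = MulAut.conj μ) :
    ∃ K : ℕ, 0 < K ∧ ∃ σ : M, φ σ = σ ∧ φ ^ K = MulAut.conj σ := by
  -- s j = μ φ(μ) ⋯ φ^{j−1}(μ). Each factor induces φ^k, so s k induces φ^{k²} = conj(μ^k) and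
  -- commutes with μ; hence φ(s k) = μ⁻¹ (s k) μ = s k.
  let s : ℕ → M := fun j => Nat.rec 1 (fun j x => x * (φ ^ j) μ) j
  have hs : ∀ j, s (j + 1) = s j * (φ ^ j) μ := fun _ => rfl
  have h1 : ∀ j, MulAut.conj (s j) = φ ^ (k * j) := by
    intro j
    induction j with
    | zero => simp [s]
    | succ j ih =>
      have hc : MulAut.conj ((φ ^ j) μ) = φ ^ j * MulAut.conj μ * (φ ^ j)⁻¹ := by
        ext x; simp
      rw [hs, map_mul, ih, hc, ← h, ← pow_add, add_comm j k, pow_add, mul_inv_cancel_right,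
        mul_add, mul_one, pow_add]
  have h2 : ∀ j, φ (s j) = μ⁻¹ * s (j + 1) := by
    intro j
    induction j with
    | zero => simp [s]
    | succ j ih =>
      rw [hs, map_mul, ih, hs (j + 1), hs j, pow_succ', MulAut.mul_apply]
      group
  have h3 : s k * μ = μ * s k := by
    have e := h1 k
    rw [pow_mul, h, ← map_pow] at e
    have := DFunLike.congr_fun e μ
    rw [MulAut.conj_apply, MulAut.conj_apply, mul_inv_eq_iff_eq_mul] at this
    rw [this, ← pow_succ, pow_succ']
    group
  refine ⟨k * k, Nat.mul_pos hk hk, s k, ?_, (h1 k).symm⟩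
  rw [h2, hs, h, MulAut.conj_apply, mul_inv_cancel_right, h3, inv_mul_cancel_left]

/-- Transfer: an equivariant homomorphism on a normal subgroup of finite index extends to a
cocycle on the whole group. -/
lemma exists_cocycle {Γ W : Type*} [Group Γ] [AddCommGroup W] [Module ℝ W] (A : Subgroup Γ)
    [A.Normal] [A.FiniteIndex] (ρ : Γ →* Module.End ℝ W) (p : Γ → W)
    (hp : ∀ a ∈ A, ∀ b ∈ A, p (a * b) = p a + p b)
    (hpρ : ∀ x, ∀ a ∈ A, p (x * a * x⁻¹) = ρ x (p a)) :
    ∃ c : Γ → W, (∀ x y, c (x * y) = c x + ρ x (c y)) ∧ ∀ a ∈ A, c a = p a := by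
  classical
  let _ : Fintype (Γ ⧸ A) := Fintype.ofFinite _
  -- The Schreier elements satisfy r(xy, q) = x r(y, q) x⁻¹ · r(x, yq). Averaging p over q and
  -- reindexing by y turns this into the cocycle law; on A, r(a, q) = a.
  let r : Γ → Γ ⧸ A → Γ := fun x q => x * q.out * (x • q).out⁻¹
  have hr : ∀ x q, r x q ∈ A := by
    intro x q
    have h1 : (QuotientGroup.mk (x * q.out) : Γ ⧸ A) = QuotientGroup.mk (x • q).out := by
      rw [QuotientGroup.out_eq']
      change x • (QuotientGroup.mk q.out : Γ ⧸ A) = _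
      rw [QuotientGroup.out_eq']
    rw [← QuotientGroup.eq_one_iff, QuotientGroup.mk_mul, QuotientGroup.mk_inv, h1,
      mul_inv_cancel]
  have hcard : (Fintype.card (Γ ⧸ A) : ℝ) ≠ 0 := Nat.cast_ne_zero.2 Fintype.card_ne_zero
  refine ⟨fun x => (Fintype.card (Γ ⧸ A) : ℝ)⁻¹ • ∑ q, p (r x q), fun x y => ?_, fun a ha => ?_⟩
  · have h1 : ∀ q, p (r (x * y) q) = ρ x (p (r y q)) + p (r x (y • q)) := by
      intro q
      rw [← hpρ x _ (hr y q), ← hp _ ((inferInstance : A.Normal).conj_mem _ (hr y q) x) _ (hr x _)]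
      congr 1
      simp only [r, mul_smul]
      group
    have h2 : ∑ q, p (r x (y • q)) = ∑ q, p (r x q) :=
      Equiv.sum_comp (MulAction.toPerm y) fun q => p (r x q)
    simp only
    rw [Finset.sum_congr rfl fun q _ => h1 q, Finset.sum_add_distrib, h2, smul_add, map_smul,
      map_sum, add_comm]
  · have h1 : ∀ q, r a q = a := by
      intro q
      have : a • q = q := by
        induction q using QuotientGroup.induction_on with
        | H x =>
          change (QuotientGroup.mk (a * x) : Γ ⧸ A) = QuotientGroup.mk x
          rw [QuotientGroup.mk_mul, (QuotientGroup.eq_one_iff a).2 ha, one_mul]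
      simp only [r, this]
      group
    simp only [h1, Finset.sum_const, Finset.card_univ]
    rw [← Nat.cast_smul_eq_nsmul ℝ, smul_smul, inv_mul_cancel₀ hcard, one_smul]

end Averaging

/-! ### The characteristic lattice of translations and its linear action -/

section Translations

variable {m : ℕ}

lemma isom_pow_zero {τ : Isom m} (h : lin τ = 1) (r : ℕ) : (τ ^ r) 0 = r • τ 0 := by
  induction r with
  | zero => simp
  | succ r ih =>
    rw [pow_succ', isom_mul_zero, h, ih, succ_nsmul, add_comm]; rfl

lemma lin_apply_of_commute {g τ : Isom m} (hl : lin τ = 1) (h : g * τ = τ * g) :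
    lin g (τ 0) = τ 0 := by
  have h1 := congrArg (fun x : Isom m => x 0) h
  simp only [isom_mul_zero, hl, LinearIsometryEquiv.coe_one, id_eq] at h1
  rw [add_comm] at h1
  exact add_right_cancel h1

lemma mul_comm_of_lin_eq_one {g τ : Isom m} (hg : lin g = 1) (hl : lin τ = 1) :
    g * τ = τ * g := by
  refine isom_ext ?_ (by rw [map_mul, map_mul, hg, hl])
  rw [isom_mul_zero, isom_mul_zero, hg, hl]
  exact add_comm _ _

/-- The translation subgroup of a group of isometries. -/
def translationSubgroup (M : Subgroup (Isom m)) : Subgroup M := (lin.comp M.subtype).ker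

instance (M : Subgroup (Isom m)) : (translationSubgroup M).Normal :=
  MonoidHom.normal_ker _

lemma mem_translationSubgroup {M : Subgroup (Isom m)} {ν : M} :
    ν ∈ translationSubgroup M ↔ lin (ν : Isom m) = 1 := Iff.rfl

lemma translationSubgroup_comm (M : Subgroup (Isom m)) :
    ∀ a ∈ translationSubgroup M, ∀ b ∈ translationSubgroup M, a * b = b * a :=
  fun _ ha _ hb => Subtype.ext (mul_comm_of_lin_eq_one ha hb)

lemma coe_zero_mem_translations {M : Subgroup (Isom m)} {τ : M}
    (hτ : τ ∈ translationSubgroup M) : (τ : Isom m) 0 ∈ translations M :=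
  ⟨τ, τ.2, hτ, rfl⟩

lemma IsSpaceGroup.finiteIndex_translationSubgroup {M : Subgroup (Isom m)}
    (hM : IsSpaceGroup M) : (translationSubgroup M).FiniteIndex := by
  have : Finite (lin.comp M.subtype).range := by
    refine (hM.finite_lin.subset ?_).to_subtype
    rintro _ ⟨ν, rfl⟩
    exact ⟨ν, ν.2, rfl⟩
  exact Subgroup.finiteIndex_ker _

lemma eq_of_eqOn_translations {M : Subgroup (Isom m)} (hM : IsSpaceGroup M)
    {f g : E m →ₗ[ℝ] E m}
    (h : ∀ τ ∈ translationSubgroup M, f ((τ : Isom m) 0) = g ((τ : Isom m) 0)) : f = g := by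
  refine LinearMap.ext_on hM.span_translations ?_
  rintro _ ⟨τ, hτ, hl, rfl⟩
  exact h ⟨τ, hτ⟩ hl

/-- Automorphisms of a space group preserve the translation subgroup. -/
lemma map_mem_translationSubgroup {M : Subgroup (Isom m)} (hM : IsSpaceGroup M) (φ : MulAut M)
    {ν : M} (hν : ν ∈ translationSubgroup M) : φ ν ∈ translationSubgroup M := by
  have := hM.finiteIndex_translationSubgroup
  set r := (translationSubgroup M).index with hr
  have hr0 : (r : ℝ) ≠ 0 := Nat.cast_ne_zero.2 Subgroup.FiniteIndex.index_ne_zero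
  have h1 : (lin (φ ν : Isom m)).toLinearEquiv.toLinearMap = LinearMap.id := by
    refine eq_of_eqOn_translations hM fun τ hτ => ?_
    -- The r-th power of φ⁻¹τ is a translation, so it commutes with ν. Hence φ ν commutes with τ ^
    -- r, its linear part fixes r · τ 0, and these vectors span.
    have h2 : φ.symm τ ^ r ∈ translationSubgroup M := Subgroup.pow_index_mem _ _
    have h3 := congrArg φ (translationSubgroup_comm M _ hν _ h2)
    rw [map_mul, map_mul, map_pow, MulEquiv.apply_symm_apply] at h3
    have h4 := lin_apply_of_commute (g := φ ν) (τ := (τ : Isom m) ^ r)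
      (by rw [map_pow, mem_translationSubgroup.1 hτ, one_pow]) (congrArg Subtype.val h3)
    rw [isom_pow_zero (mem_translationSubgroup.1 hτ), ← Nat.cast_smul_eq_nsmul ℝ, map_smul] at h4
    exact smul_right_injective _ hr0 h4
  rw [mem_translationSubgroup]
  ext1 x
  exact LinearMap.congr_fun h1 x

/-- A ℤ-basis of a full lattice is an ℝ-basis of the space. -/
lemma exists_linear_extension {L : AddSubgroup (E m)} [DiscreteTopology L]
    (hL : Submodule.span ℝ (L : Set (E m)) = ⊤) (f : L →+ E m) :
    ∃ F : E m →ₗ[ℝ] E m, ∀ l : L, F l = f l := by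
  let L' : Submodule ℤ (E m) := AddSubgroup.toIntSubmodule L
  have hd : DiscreteTopology L' := (inferInstance : DiscreteTopology L)
  have hz : IsZLattice ℝ L' := ⟨hL⟩
  have := ZLattice.module_free ℝ L'
  let b := Module.Free.chooseBasis ℤ L'
  let B := b.ofZLatticeBasis ℝ L'
  let f' : L' →ₗ[ℤ] E m := AddMonoidHom.toIntLinearMap f
  let F : E m →ₗ[ℝ] E m := B.constr ℝ fun i => f' (b i)
  refine ⟨F, fun l => ?_⟩
  have h1 : (F.restrictScalars ℤ).comp L'.subtype = f' := by
    refine b.ext fun i => ?_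
    have h2 : F (B i) = f' (b i) := Module.Basis.constr_basis _ _ _ _
    rw [Module.Basis.ofZLatticeBasis_apply] at h2
    exact h2
  exact LinearMap.congr_fun h1 l

/-- Automorphisms of a space group act linearly, extending the action on translations. -/
lemma exists_linear_action {M : Subgroup (Isom m)} (hM : IsSpaceGroup M) :
    ∃ R : MulAut M →* Module.End ℝ (E m), ∀ (φ : MulAut M), ∀ τ ∈ translationSubgroup M,
      R φ ((τ : Isom m) 0) = (φ τ : Isom m) 0 := by
  have hd := discreteTopology_translations hM.discrete
  have ex : ∀ φ : MulAut M, ∃ F : Module.End ℝ (E m), ∀ τ ∈ translationSubgroup M,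
      F ((τ : Isom m) 0) = (φ τ : Isom m) 0 := by
    intro φ
    have hu : ∀ a : translations M, ∃ τ ∈ translationSubgroup M, (τ : Isom m) 0 = a := by
      rintro ⟨_, τ, hτ, hl, rfl⟩
      exact ⟨⟨τ, hτ⟩, hl, rfl⟩
    choose t ht ht0 using hu
    have huniq : ∀ τ ∈ translationSubgroup M, ∀ a : translations M,
        (τ : Isom m) 0 = a → t a = τ := by
      intro τ hτ a ha
      refine Subtype.ext (isom_ext ?_ ?_)
      · rw [ht0, ha]
      · rw [mem_translationSubgroup.1 hτ, mem_translationSubgroup.1 (ht a)]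
    let f : translations M →+ E m := AddMonoidHom.mk' (fun a => (φ (t a) : Isom m) 0) (by
      intro a b
      have h1 : t (a + b) = t a * t b := by
        refine huniq _ (Subgroup.mul_mem _ (ht a) (ht b)) _ ?_
        rw [Subgroup.coe_mul, isom_mul_zero, mem_translationSubgroup.1 (ht a), ht0, ht0]
        rfl
      rw [h1, map_mul, Subgroup.coe_mul, isom_mul_zero,
        mem_translationSubgroup.1 (map_mem_translationSubgroup hM φ (ht a))]
      rfl)
    obtain ⟨F, hF⟩ := exists_linear_extension hM.span_translations f
    refine ⟨F, fun τ hτ => ?_⟩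
    have h2 := hF ⟨_, coe_zero_mem_translations hτ⟩
    have h3 := huniq τ hτ ⟨_, coe_zero_mem_translations hτ⟩ rfl
    simp only [f, AddMonoidHom.mk'_apply, h3] at h2
    exact h2
  choose F hF using ex
  refine ⟨⟨⟨F, ?_⟩, ?_⟩, hF⟩
  · refine eq_of_eqOn_translations hM fun τ hτ => ?_
    rw [hF _ τ hτ]; rfl
  · intro φ ψ
    refine eq_of_eqOn_translations hM fun τ hτ => ?_
    rw [hF _ τ hτ, Module.End.mul_apply, hF _ τ hτ, hF _ _ (map_mem_translationSubgroup hM ψ hτ)]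
    rfl

lemma linear_action_conj {M : Subgroup (Isom m)} (hM : IsSpaceGroup M)
    {R : MulAut M →* Module.End ℝ (E m)} (hR : ∀ (φ : MulAut M), ∀ τ ∈ translationSubgroup M,
      R φ ((τ : Isom m) 0) = (φ τ : Isom m) 0) (ν : M) :
    R (MulAut.conj ν) = (lin (ν : Isom m)).toLinearEquiv.toLinearMap := by
  refine eq_of_eqOn_translations hM fun τ hτ => ?_
  rw [hR _ τ hτ, MulAut.conj_apply]
  have hl := mem_translationSubgroup.1 hτ
  change ((ν : Isom m) * τ * (ν : Isom m)⁻¹) 0 = lin (ν : Isom m) ((τ : Isom m) 0)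
  rw [isom_mul_zero, isom_mul_zero, map_mul, hl, mul_one, isom_inv_zero, map_neg, map_inv,
    apply_inv_self']
  abel

end Translations

/-! ### Affine actions of mapping torus groups -/

section AffineAction

variable {G : Type*} [Group G]

/-- The mapping torus group of an automorphism. -/
abbrev MappingTorus (φ : MulAut G) : Type _ :=
  G ⋊[zpowersHom (MulAut G) φ] Multiplicative ℤ

/-- The action of the mapping torus group by conjugation. -/
def torusConj (φ : MulAut G) : MappingTorus φ →* MulAut G :=
  SemidirectProduct.lift MulAut.conj (zpowersHom (MulAut G) φ) (by
    intro i
    ext μ x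
    simp only [MonoidHom.comp_apply, MulEquiv.coe_toMonoidHom, zpowersHom_apply, MulAut.conj_apply,
      MulAut.mul_apply, map_mul, map_inv, MulAut.apply_inv_self])

lemma torusConj_apply (φ : MulAut G) (x : MappingTorus φ) :
    torusConj φ x = MulAut.conj x.left * φ ^ (Multiplicative.toAdd x.right) := rfl

lemma torusConj_inl (φ : MulAut G) (μ : G) :
    torusConj φ (SemidirectProduct.inl μ) = MulAut.conj μ := SemidirectProduct.lift_inl _ _ _ _

lemma inl_torusConj (φ : MulAut G) (x : MappingTorus φ) (μ : G) :
    (SemidirectProduct.inl (torusConj φ x μ) : MappingTorus φ)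
      = x * SemidirectProduct.inl μ * x⁻¹ := by
  rw [eq_mul_inv_iff_mul_eq]
  refine SemidirectProduct.ext ?_ ?_
  · simp [torusConj_apply]
  · simp

/-- The element of the mapping torus group given by a power of the stable letter and an element
inducing the same automorphism. -/
def torusCentral (φ : MulAut G) (K : ℕ) (σ : G) : MappingTorus φ :=
  ⟨σ⁻¹, Multiplicative.ofAdd (K : ℤ)⟩

section Central

variable {φ : MulAut G} {K : ℕ} {σ : G}

/-- On the fiber t^K acts as conj σ, which σ⁻¹ cancels; φ σ = σ makes the element commute with t as
well. -/
lemma torusCentral_zpow_mul (hσ : φ σ = σ) (hφ : φ ^ K = MulAut.conj σ) (j : ℤ)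
    (x : MappingTorus φ) : torusCentral φ K σ ^ j * x = x * torusCentral φ K σ ^ j := by
  have hφz : ∀ i : ℤ, (φ ^ i) σ = σ := by
    intro i
    have : φ ∈ MulAction.stabilizer (MulAut G) σ := hσ
    exact Subgroup.zpow_mem _ this i
  have hS : torusCentral φ K σ * x = x * torusCentral φ K σ := by
    refine SemidirectProduct.ext ?_ (mul_comm _ _)
    simp only [torusCentral, SemidirectProduct.mul_left, zpowersHom_apply, toAdd_ofAdd,
      zpow_natCast, hφ, MulAut.conj_apply, map_inv, hφz]
    group
  exact (Commute.zpow_left (hS : Commute _ x) j).eq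

lemma torusConj_torusCentral (hφ : φ ^ K = MulAut.conj σ) :
    torusConj φ (torusCentral φ K σ) = 1 := by
  rw [torusConj_apply]
  simp only [torusCentral, toAdd_ofAdd, zpow_natCast, hφ, map_inv, inv_mul_cancel]

lemma toAdd_torusCentral_zpow_right (j : ℤ) :
    Multiplicative.toAdd (torusCentral φ K σ ^ j).right = K * j := by
  have := map_zpow (SemidirectProduct.rightHom : MappingTorus φ →* _) (torusCentral φ K σ) j
  rw [SemidirectProduct.rightHom_eq_right] at this
  rw [this, toAdd_zpow, smul_eq_mul, mul_comm]
  rfl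

lemma inl_mul_torusCentral_mul (hσ : φ σ = σ) (hφ : φ ^ K = MulAut.conj σ) (τ τ' : G) (j j' : ℤ) :
    (SemidirectProduct.inl τ * torusCentral φ K σ ^ j)
        * (SemidirectProduct.inl τ' * torusCentral φ K σ ^ j')
      = SemidirectProduct.inl (τ * τ') * torusCentral φ K σ ^ (j + j') := by
  rw [map_mul, zpow_add, mul_assoc, ← mul_assoc (torusCentral φ K σ ^ j),
    torusCentral_zpow_mul hσ hφ]
  simp only [mul_assoc]

lemma conj_inl_mul_torusCentral (hσ : φ σ = σ) (hφ : φ ^ K = MulAut.conj σ) (x : MappingTorus φ)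
    (τ : G) (j : ℤ) : x * (SemidirectProduct.inl τ * torusCentral φ K σ ^ j) * x⁻¹
      = SemidirectProduct.inl (torusConj φ x τ) * torusCentral φ K σ ^ j := by
  rw [inl_torusConj, mul_assoc, mul_assoc (SemidirectProduct.inl τ), torusCentral_zpow_mul hσ hφ]
  simp only [mul_assoc]

/-- The subgroup of the mapping torus group generated by a subgroup of the fiber and the central
element. -/
def torusSubgroup (hσ : φ σ = σ) (hφ : φ ^ K = MulAut.conj σ) (T : Subgroup G) :
    Subgroup (MappingTorus φ) where
  carrier := {x | ∃ τ ∈ T, ∃ j : ℤ, x = SemidirectProduct.inl τ * torusCentral φ K σ ^ j}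
  one_mem' := ⟨1, T.one_mem, 0, by simp⟩
  mul_mem' := by
    rintro _ _ ⟨τ, hτ, j, rfl⟩ ⟨τ', hτ', j', rfl⟩
    exact ⟨τ * τ', T.mul_mem hτ hτ', j + j', inl_mul_torusCentral_mul hσ hφ _ _ _ _⟩
  inv_mem' := by
    rintro _ ⟨τ, hτ, j, rfl⟩
    refine ⟨τ⁻¹, T.inv_mem hτ, -j, ?_⟩
    rw [mul_inv_rev, ← zpow_neg, torusCentral_zpow_mul hσ hφ, map_inv]

lemma normal_torusSubgroup (hσ : φ σ = σ) (hφ : φ ^ K = MulAut.conj σ) {T : Subgroup G}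
    (hT : ∀ (ψ : MulAut G), ∀ τ ∈ T, ψ τ ∈ T) : (torusSubgroup hσ hφ T).Normal := ⟨by
  rintro _ ⟨τ, hτ, j, rfl⟩ x
  exact ⟨_, hT _ _ hτ, j, conj_inl_mul_torusCentral hσ hφ x τ j⟩⟩

variable (φ K σ) in
/-- A representative modulo the powers of the central element. -/
def torusReduce (x : MappingTorus φ) : MappingTorus φ :=
  x * torusCentral φ K σ ^ (-(Multiplicative.toAdd x.right / K))

lemma toAdd_torusReduce_right (x : MappingTorus φ) :
    Multiplicative.toAdd (torusReduce φ K σ x).right = Multiplicative.toAdd x.right % K := by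
  rw [torusReduce, SemidirectProduct.mul_right, toAdd_mul, toAdd_torusCentral_zpow_right,
    Int.emod_def]
  ring

lemma torusReduce_inl_mul (hK : 0 < K) (τ : G) (j : ℤ) :
    torusReduce φ K σ (SemidirectProduct.inl τ * torusCentral φ K σ ^ j)
      = SemidirectProduct.inl τ := by
  have hK' : (K : ℤ) ≠ 0 := by exact_mod_cast hK.ne'
  rw [torusReduce, SemidirectProduct.mul_right, toAdd_mul, toAdd_torusCentral_zpow_right,
    SemidirectProduct.right_inl, toAdd_one, zero_add, Int.mul_ediv_cancel_left _ hK', mul_assoc,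
    ← zpow_add, add_neg_cancel, zpow_zero, mul_one]

lemma inv_mul_torusReduce_mem (hσ : φ σ = σ) (hφ : φ ^ K = MulAut.conj σ) (T : Subgroup G)
    (x : MappingTorus φ) : x⁻¹ * torusReduce φ K σ x ∈ torusSubgroup hσ hφ T :=
  ⟨1, T.one_mem, -(Multiplicative.toAdd x.right / K), by
    rw [torusReduce, inv_mul_cancel_left, map_one, one_mul]⟩

/-- Powers of the central element bring the exponent of t into [0, K). That residue and the class of
the fiber part modulo T then determine the coset. -/
lemma finiteIndex_torusSubgroup (hK : 0 < K) (hσ : φ σ = σ) (hφ : φ ^ K = MulAut.conj σ)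
    {T : Subgroup G} [T.FiniteIndex] (hT : ∀ (ψ : MulAut G), ∀ τ ∈ T, ψ τ ∈ T) :
    (torusSubgroup hσ hφ T).FiniteIndex := by
  have hK' : (K : ℤ) ≠ 0 := by exact_mod_cast hK.ne'
  have hAn := normal_torusSubgroup hσ hφ hT
  set A := torusSubgroup hσ hφ T
  let f : MappingTorus φ → (G ⧸ T) × ℤ := fun x =>
    (QuotientGroup.mk (torusReduce φ K σ x).left, Multiplicative.toAdd x.right % K)
  have hf : ∀ x y, f x = f y → x⁻¹ * y ∈ A := by
    intro x y hxy
    have h1 := QuotientGroup.eq.1 (congrArg Prod.fst hxy)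
    have h2 : Multiplicative.toAdd x.right % K = Multiplicative.toAdd y.right % K :=
      congrArg Prod.snd hxy
    set u := torusReduce φ K σ x with hu
    set v := torusReduce φ K σ y with hv
    have h3 : v * u⁻¹ ∈ A := by
      refine ⟨v.left * u.left⁻¹, ?_, 0, ?_⟩
      · have := hT (MulAut.conj u.left) _ h1
        rw [MulAut.conj_apply] at this
        convert this using 1
        group
      · have h4 : v.right = u.right := by
          refine Multiplicative.toAdd.injective ?_
          rw [hu, hv, toAdd_torusReduce_right, toAdd_torusReduce_right, h2]
        rw [zpow_zero, mul_one, mul_inv_eq_iff_eq_mul]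
        refine SemidirectProduct.ext ?_ ?_
        · simp
        · simpa using h4
    have h5 : u⁻¹ * v ∈ A := by
      have := hAn.conj_mem _ h3 u⁻¹
      convert this using 1
      group
    have h6 := A.mul_mem (A.mul_mem (inv_mul_torusReduce_mem hσ hφ T x) h5)
      (A.inv_mem (inv_mul_torusReduce_mem hσ hφ T y))
    convert h6 using 1
    rw [← hu, ← hv]
    group
  have hfin : (Set.range f).Finite := by
    refine (Set.finite_univ.prod (Set.finite_Ico (0 : ℤ) K)).subset ?_
    rintro _ ⟨x, rfl⟩
    exact ⟨trivial, Int.emod_nonneg _ hK', Int.emod_lt_of_pos _ (by exact_mod_cast hK)⟩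
  have := hfin.to_subtype
  have : Finite (MappingTorus φ ⧸ A) := by
    refine Finite.of_injective
      (fun q : MappingTorus φ ⧸ A => (⟨f q.out, q.out, rfl⟩ : Set.range f)) fun q q' hq => ?_
    have h7 := hf _ _ (congrArg Subtype.val hq)
    rw [← QuotientGroup.eq, QuotientGroup.out_eq', QuotientGroup.out_eq'] at h7
    exact h7
  exact Subgroup.finiteIndex_of_finite_quotient

/-- A linear action of the automorphisms of `G` with an equivariant homomorphism on a
characteristic subgroup of finite index yields an affine action of the mapping torus group of an
automorphism of finite outer order, through a finite linear group. -/
lemma exists_torus_cocycle (hK : 0 < K) (hσ : φ σ = σ) (hφ : φ ^ K = MulAut.conj σ)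
    {T : Subgroup G} [T.FiniteIndex] (hT : ∀ (ψ : MulAut G), ∀ τ ∈ T, ψ τ ∈ T)
    {W : Type*} [AddCommGroup W] [Module ℝ W] (R : MulAut G →* Module.End ℝ W) (p : G → W)
    (hp : ∀ τ ∈ T, ∀ τ' ∈ T, p (τ * τ') = p τ + p τ')
    (hR : ∀ (ψ : MulAut G), ∀ τ ∈ T, R ψ (p τ) = p (ψ τ))
    (hT1 : ∀ τ ∈ T, R (MulAut.conj τ) = 1) :
    (Set.range (R.comp (torusConj φ))).Finite ∧ ∃ c : MappingTorus φ → W,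
      (∀ x y, c (x * y) = c x + R (torusConj φ x) (c y)) ∧
      ∀ τ ∈ T, c (SemidirectProduct.inl τ) = p τ := by
  have hAn := normal_torusSubgroup hσ hφ hT
  have hAf := finiteIndex_torusSubgroup hK hσ hφ hT
  -- Reduction removes the central power, so this function extends p from T with value zero on the
  -- central element.
  have hpA : ∀ (τ : G) (j : ℤ), p (torusReduce φ K σ
      (SemidirectProduct.inl τ * torusCentral φ K σ ^ j)).left = p τ := by
    intro τ j
    rw [torusReduce_inl_mul hK, SemidirectProduct.left_inl]
  obtain ⟨c, hc, hcA⟩ := exists_cocycle (torusSubgroup hσ hφ T) (R.comp (torusConj φ))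
    (fun x => p (torusReduce φ K σ x).left) (by
      rintro _ ⟨τ, hτ, j, rfl⟩ _ ⟨τ', hτ', j', rfl⟩
      rw [inl_mul_torusCentral_mul hσ hφ, hpA, hpA, hpA, hp _ hτ _ hτ']) (by
      rintro x _ ⟨τ, hτ, j, rfl⟩
      rw [conj_inl_mul_torusCentral hσ hφ, hpA, hpA]
      exact (hR _ τ hτ).symm)
  have hρA : ∀ a ∈ torusSubgroup hσ hφ T, R.comp (torusConj φ) a = 1 := by
    rintro _ ⟨τ, hτ, j, rfl⟩
    rw [MonoidHom.comp_apply, map_mul, map_zpow, torusConj_torusCentral hφ, one_zpow, mul_one,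
      torusConj_inl, hT1 τ hτ]
  refine ⟨?_, c, hc, fun τ hτ => ?_⟩
  · refine (Set.finite_range fun q : MappingTorus φ ⧸ torusSubgroup hσ hφ T =>
      R.comp (torusConj φ) q.out).subset ?_
    rintro _ ⟨x, rfl⟩
    refine ⟨QuotientGroup.mk x, ?_⟩
    have h1 : x⁻¹ * (QuotientGroup.mk x : MappingTorus φ ⧸ torusSubgroup hσ hφ T).out
        ∈ torusSubgroup hσ hφ T := QuotientGroup.eq.1 (QuotientGroup.out_eq' _).symm
    have h2 := hρA _ h1
    have h3 : ∀ y, R.comp (torusConj φ) (x⁻¹ * y) = 1 →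
        R.comp (torusConj φ) y = R.comp (torusConj φ) x := by
      intro y hy
      rw [← mul_one (R.comp (torusConj φ) x), ← hy, ← map_mul, mul_inv_cancel_left]
    exact h3 _ h2
  · have h1 : (SemidirectProduct.inl τ : MappingTorus φ)
        = SemidirectProduct.inl τ * torusCentral φ K σ ^ (0 : ℤ) := by
      rw [zpow_zero, mul_one]
    rw [hcA _ ⟨τ, hτ, 0, h1⟩, h1]
    exact hpA τ 0

end Central

variable {m : ℕ} {M : Subgroup (Isom m)}

/-- If a power of `φ` is inner, then the mapping torus group of `φ` acts affinely, through a
finite linear group, extending the action of the translations. -/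
lemma exists_affine_action (hM : IsSpaceGroup M) (φ : MulAut M) {K : ℕ} (hK : 0 < K) {σ : M}
    (hσ : φ σ = σ) (hφ : φ ^ K = MulAut.conj σ) :
    ∃ (ρ : MappingTorus φ →* Module.End ℝ (E m)) (c : MappingTorus φ → E m),
      (Set.range ρ).Finite ∧ (∀ x y, c (x * y) = c x + ρ x (c y)) ∧
      (∀ ν : M, ρ (SemidirectProduct.inl ν) = (lin (ν : Isom m)).toLinearEquiv.toLinearMap) ∧
      ∀ τ ∈ translationSubgroup M, c (SemidirectProduct.inl τ) = (τ : Isom m) 0 := by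
  obtain ⟨R, hR⟩ := exists_linear_action hM
  have := hM.finiteIndex_translationSubgroup
  obtain ⟨hfin, c, hc, hcT⟩ := exists_torus_cocycle hK hσ hφ
    (fun ψ τ hτ => map_mem_translationSubgroup hM ψ hτ) R (fun τ => (τ : Isom m) 0) (by
      intro τ hτ τ' hτ'
      rw [Subgroup.coe_mul, isom_mul_zero, mem_translationSubgroup.1 hτ]
      rfl) hR (by
      intro τ hτ
      rw [linear_action_conj hM hR, mem_translationSubgroup.1 hτ]
      rfl)
  refine ⟨R.comp (torusConj φ), c, hfin, hc, fun ν => ?_, hcT⟩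
  rw [MonoidHom.comp_apply, torusConj_inl, linear_action_conj hM hR]

end AffineAction


/-! ### Realizing the mapping torus as a space group -/

section Realization

variable {m : ℕ}

/-- A linear representation with finite image is orthogonal for a suitable inner product. -/
lemma exists_isometrization {Γ : Type*} [Group Γ] (ρ : Γ →* Module.End ℝ (E m))
    (hfin : (Set.range ρ).Finite) :
    ∃ (Q : (E m × ℝ) ≃ₗ[ℝ] E (m + 1)) (b : E m → E m → ℝ),
      (∀ u v, inner ℝ (Q u) (Q v) = b u.1 v.1 + u.2 * v.2) ∧
      ∀ x w w', b (ρ x w) (ρ x w') = b w w' := by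
  classical
  have := hfin.to_subtype
  let _ : Fintype (Set.range ρ) := Fintype.ofFinite _
  let ι : (E m × ℝ) →ₗ[ℝ] WithLp 2 (PiLp 2 (fun _ : Set.range ρ => E m) × ℝ) :=
    (WithLp.linearEquiv 2 ℝ (PiLp 2 (fun _ : Set.range ρ => E m) × ℝ)).symm.toLinearMap.comp
      ((((WithLp.linearEquiv 2 ℝ (Set.range ρ → E m)).symm.toLinearMap.comp
        (LinearMap.pi fun B : Set.range ρ => (B : Module.End ℝ (E m))))).prodMap LinearMap.id)
  -- The inner product summed over the finite image of ρ. It is pulled back along ι, whose range is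
  -- a Euclidean space of dimension m + 1; right multiplication by ρ x permutes the summands.
  let b : E m → E m → ℝ := fun w w' => ∑ B : Set.range ρ,
    inner ℝ ((B : Module.End ℝ (E m)) w) ((B : Module.End ℝ (E m)) w')
  have hι : ∀ u v, inner ℝ (ι u) (ι v) = b u.1 v.1 + u.2 * v.2 := by
    intro u v
    rw [WithLp.prod_inner_apply, PiLp.inner_apply, mul_comm]
    rfl
  have hinj : Function.Injective ι := by
    refine (injective_iff_map_eq_zero ι).2 fun u hu => ?_
    have h1 : (1 : Module.End ℝ (E m)) u.1 = 0 :=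
      congrFun (congrArg (fun z => WithLp.ofLp (WithLp.ofLp z).1) hu) ⟨1, 1, map_one ρ⟩
    have h2 : u.2 = 0 := congrArg (fun z => (WithLp.ofLp z).2) hu
    exact Prod.ext h1 h2
  have hdim : Module.finrank ℝ (LinearMap.range ι) = m + 1 := by
    rw [LinearMap.finrank_range_of_inj hinj, Module.finrank_prod, finrank_euclideanSpace_fin,
      Module.finrank_self]
  let r : LinearMap.range ι ≃ₗᵢ[ℝ] E (m + 1) :=
    ((stdOrthonormalBasis ℝ (LinearMap.range ι)).reindex (finCongr hdim)).repr
  refine ⟨(LinearEquiv.ofInjective ι hinj).trans r.toLinearEquiv, b, fun u v => ?_,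
    fun x w w' => ?_⟩
  · rw [← hι]
    exact LinearIsometryEquiv.inner_map_map (𝕜 := ℝ) r (LinearEquiv.ofInjective ι hinj u)
      (LinearEquiv.ofInjective ι hinj v)
  · let e : Set.range ρ ≃ Set.range ρ :=
      { toFun := fun B => ⟨B * ρ x, by
          obtain ⟨_, y, rfl⟩ := B
          exact ⟨y * x, map_mul ρ y x⟩⟩
        invFun := fun B => ⟨B * ρ x⁻¹, by
          obtain ⟨_, y, rfl⟩ := B
          exact ⟨y * x⁻¹, map_mul ρ y x⁻¹⟩⟩
        left_inv := fun B => Subtype.ext (by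
          simp only [mul_assoc, ← map_mul, mul_inv_cancel, map_one, mul_one])
        right_inv := fun B => Subtype.ext (by
          simp only [mul_assoc, ← map_mul, inv_mul_cancel, map_one, mul_one]) }
    exact Equiv.sum_comp e fun B : Set.range ρ =>
      inner ℝ ((B : Module.End ℝ (E m)) w) ((B : Module.End ℝ (E m)) w')

lemma exists_orthogonal_rep {Γ : Type*} [Group Γ] (ρ : Γ →* Module.End ℝ (E m)) {n : ℕ}
    (Q : (E m × ℝ) ≃ₗ[ℝ] E n) (hQ : ∀ x u, ‖Q (ρ x u.1, u.2)‖ = ‖Q u‖) :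
    ∃ U : Γ →* (E n ≃ₗᵢ[ℝ] E n), ∀ x u, U x (Q u) = Q (ρ x u.1, u.2) := by
  have hinv : ∀ x w, ρ x⁻¹ (ρ x w) = w := by
    intro x w
    rw [← Module.End.mul_apply, ← map_mul, inv_mul_cancel, map_one]; rfl
  let L : Γ → ((E m × ℝ) ≃ₗ[ℝ] (E m × ℝ)) := fun x =>
    LinearEquiv.ofLinearMap ((ρ x).prodMap LinearMap.id) ((ρ x⁻¹).prodMap LinearMap.id)
      (LinearMap.ext fun u => Prod.ext (by
        have := hinv x⁻¹ u.1
        rwa [inv_inv] at this) rfl)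
      (LinearMap.ext fun u => Prod.ext (hinv x u.1) rfl)
  let U : Γ → (E n ≃ₗᵢ[ℝ] E n) := fun x =>
    { toLinearEquiv := (Q.symm.trans (L x)).trans Q
      norm_map' := fun y => by
        have := hQ x (Q.symm y)
        rw [Q.apply_symm_apply] at this
        exact this }
  have hU : ∀ x u, U x (Q u) = Q (ρ x u.1, u.2) := fun x u =>
    congrArg (fun z : E m × ℝ => Q (ρ x z.1, z.2)) (Q.symm_apply_apply u)
  refine ⟨⟨⟨U, ?_⟩, ?_⟩, hU⟩
  · ext1 y
    obtain ⟨u, rfl⟩ := Q.surjective y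
    rw [hU, map_one]; rfl
  · intro x x'
    ext1 y
    obtain ⟨u, rfl⟩ := Q.surjective y
    rw [LinearIsometryEquiv.coe_mul, Function.comp_apply, hU, hU, hU, map_mul]; rfl

/-- The isometric action defined by a cocycle of an orthogonal representation. -/
def isomOfCocycle {Γ : Type*} [Group Γ] {n : ℕ} (U : Γ →* (E n ≃ₗᵢ[ℝ] E n)) (a : Γ → E n)
    (ha : ∀ x y, a (x * y) = a x + U x (a y)) : Γ →* Isom n :=
  MonoidHom.mk' (fun x => (U x).toAffineIsometryEquiv.trans
    (AffineIsometryEquiv.constVAdd ℝ (E n) (a x))) (by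
      intro x x'
      ext1 y
      change a (x * x') + U (x * x') y = a x + U x (a x' + U x' y)
      rw [ha, map_mul, map_add, add_assoc]; rfl)

lemma isomOfCocycle_apply {Γ : Type*} [Group Γ] {n : ℕ} (U : Γ →* (E n ≃ₗᵢ[ℝ] E n)) (a : Γ → E n)
    (ha : ∀ x y, a (x * y) = a x + U x (a y)) (x : Γ) (y : E n) :
    isomOfCocycle U a ha x y = a x + U x y := rfl

lemma lin_isomOfCocycle {Γ : Type*} [Group Γ] {n : ℕ} (U : Γ →* (E n ≃ₗᵢ[ℝ] E n)) (a : Γ → E n)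
    (ha : ∀ x y, a (x * y) = a x + U x (a y)) (x : Γ) :
    lin (isomOfCocycle U a ha x) = U x := by
  ext1 y
  have h := isom_apply (isomOfCocycle U a ha x) y
  rw [isomOfCocycle_apply, isomOfCocycle_apply, map_zero, add_zero] at h
  exact (add_left_cancel h).symm

variable {M : Subgroup (Isom m)}

/-- There are finitely many linear parts. Two elements with the same one differ by a translation
whose vector is the difference of their values of c. -/
lemma finite_bounded_cocycle (hM : IsSpaceGroup M) {c : M → E m}
    (hc : ∀ τ ∈ translationSubgroup M, ∀ ν, c (τ * ν) = (τ : Isom m) 0 + c ν) (C : ℝ) :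
    {ν : M | ‖c ν‖ ≤ C}.Finite := by
  refine Set.Finite.of_finite_fibers (fun ν : M => lin (ν : Isom m)) ?_ ?_
  · refine hM.finite_lin.subset ?_
    rintro _ ⟨ν, -, rfl⟩
    exact ⟨ν, ν.2, rfl⟩
  · rintro _ ⟨ν₀, hν₀, rfl⟩
    have key : ∀ ν : M, lin (ν : Isom m) = lin (ν₀ : Isom m) →
        ν * ν₀⁻¹ ∈ translationSubgroup M ∧ c ν - c ν₀ = ((ν * ν₀⁻¹ : M) : Isom m) 0 := by
      intro ν hν
      have h1 : ν * ν₀⁻¹ ∈ translationSubgroup M := by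
        rw [mem_translationSubgroup, Subgroup.coe_mul, Subgroup.coe_inv, map_mul, map_inv, hν,
          mul_inv_cancel]
      refine ⟨h1, ?_⟩
      have h2 := hc _ h1 ν₀
      rw [inv_mul_cancel_right] at h2
      rw [h2, add_sub_cancel_right]
    refine Set.Finite.of_injOn (f := fun ν => c ν - c ν₀) (t := {a | a ∈ translations M ∧
      ‖a‖ ≤ C + C}) ?_ ?_ (finite_translations hM.discrete _)
    · rintro ν ⟨hν, hl⟩
      obtain ⟨h1, h2⟩ := key ν hl
      refine ⟨?_, (norm_sub_le _ _).trans (add_le_add hν hν₀)⟩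
      simp only [h2]
      exact coe_zero_mem_translations h1
    · rintro ν ⟨-, hl⟩ ν' ⟨-, hl'⟩ he
      obtain ⟨h1, h2⟩ := key ν hl
      obtain ⟨h1', h2'⟩ := key ν' hl'
      simp only [h2, h2'] at he
      have h3 : ν * ν₀⁻¹ = ν' * ν₀⁻¹ := Subtype.ext (isom_ext he
        ((mem_translationSubgroup.1 h1).trans (mem_translationSubgroup.1 h1').symm))
      exact mul_right_cancel h3

/-- The exponent of the stable letter, as a real number. -/
def torusHeight {G : Type*} [Group G] {φ : MulAut G} (x : MappingTorus φ) : ℝ :=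
  ((Multiplicative.toAdd x.right : ℤ) : ℝ)

section Height

variable {G : Type*} [Group G] {φ : MulAut G}

lemma torusHeight_mul (x y : MappingTorus φ) :
    torusHeight (x * y) = torusHeight x + torusHeight y := by
  rw [torusHeight, SemidirectProduct.mul_right, toAdd_mul, Int.cast_add]; rfl

lemma torusHeight_inl (μ : G) : torusHeight (SemidirectProduct.inl μ : MappingTorus φ) = 0 := by
  rw [torusHeight, SemidirectProduct.right_inl, toAdd_one, Int.cast_zero]

lemma torusHeight_inr (i : ℤ) :
    torusHeight (SemidirectProduct.inr (Multiplicative.ofAdd i) : MappingTorus φ) = i := by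
  rw [torusHeight, SemidirectProduct.right_inr, toAdd_ofAdd]

lemma right_eq_one_of_abs_torusHeight_lt {x : MappingTorus φ} (hx : |torusHeight x| < 1) :
    x.right = 1 := by
  refine Multiplicative.toAdd.injective (Int.abs_lt_one_iff.1 ?_)
  rw [torusHeight] at hx
  exact_mod_cast hx

lemma torusHeight_eq_zero_iff {x : MappingTorus φ} : torusHeight x = 0 ↔ x.right = 1 := by
  refine ⟨fun hx => right_eq_one_of_abs_torusHeight_lt (by simp [hx]), fun hx => ?_⟩
  rw [torusHeight, hx, toAdd_one, Int.cast_zero]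

lemma eq_inl_of_right_eq_one {x : MappingTorus φ} (hx : x.right = 1) :
    x = SemidirectProduct.inl x.left :=
  SemidirectProduct.ext rfl hx

end Height

set_option maxHeartbeats 1000000 in
/-- The mapping torus group of an automorphism of finite outer order of a space group is a space
group in which the fiber is complete. -/
lemma exists_realization (hM : IsSpaceGroup M) (φ : MulAut M) {K : ℕ} (hK : 0 < K) {σ : M}
    (hσ : φ σ = σ) (hφ : φ ^ K = MulAut.conj σ) :
    ∃ (Ψ : MappingTorus φ →* Isom (m + 1)) (V : Submodule ℝ (E (m + 1))),
      Function.Injective Ψ ∧ IsSpaceGroup Ψ.range ∧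
      V = Submodule.span ℝ {a | ∃ ν : M, ∀ y, Ψ (SemidirectProduct.inl ν) y = a + y} ∧
      ∀ x, x.right = 1 ↔ (Ψ x 0 ∈ V ∧ ∀ w ∈ Vᗮ, lin (Ψ x) w = w) := by
  obtain ⟨ρ, c, hfin, hc, hρM, hcT⟩ := exists_affine_action hM φ hK hσ hφ
  obtain ⟨Q, b, hQ, hb⟩ := exists_isometrization ρ hfin
  obtain ⟨U, hU⟩ := exists_orthogonal_rep ρ Q (by
    intro x u
    rw [norm_eq_sqrt_real_inner, norm_eq_sqrt_real_inner, hQ, hQ, hb])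
  have ha : ∀ x y : MappingTorus φ, Q (c (x * y), torusHeight (x * y))
      = Q (c x, torusHeight x) + U x (Q (c y, torusHeight y)) := by
    intro x y
    rw [hU, ← map_add, hc, torusHeight_mul]; rfl
  set Ψ := isomOfCocycle U (fun x => Q (c x, torusHeight x)) ha with hΨ
  have hΨQ : ∀ x u, Ψ x (Q u) = Q (c x + ρ x u.1, torusHeight x + u.2) := by
    intro x u
    rw [hΨ, isomOfCocycle_apply, hU, ← map_add]; rfl
  have hΨ0 : ∀ x, Ψ x 0 = Q (c x, torusHeight x) := by
    intro x
    rw [hΨ, isomOfCocycle_apply, map_zero, add_zero]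
  have hlin : ∀ x, lin (Ψ x) = U x := fun x => lin_isomOfCocycle U _ ha x
  have hρT : ∀ τ ∈ translationSubgroup M, ρ (SemidirectProduct.inl τ) = 1 := by
    intro τ hτ
    rw [hρM, mem_translationSubgroup.1 hτ]; rfl
  -- The extra coordinate is orthogonal to E^m, so the height is bounded by the norm.
  have hnorm : ∀ w s, s ^ 2 ≤ ‖Q (w, s)‖ ^ 2 := by
    intro w s
    have h1 : 0 ≤ b w w := by
      have := hQ (w, 0) (w, 0)
      simp only [mul_zero, add_zero] at this
      rw [← this]
      exact real_inner_self_nonneg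
    rw [← real_inner_self_eq_norm_sq, hQ]
    nlinarith
  set V := Submodule.span ℝ {a | ∃ ν : M, ∀ y, Ψ (SemidirectProduct.inl ν) y = a + y} with hV
  have hVsub : ∀ v ∈ V, (Q.symm v).2 = 0 := by
    intro v hv
    induction hv using Submodule.span_induction with
    | mem a ha' =>
      obtain ⟨ν, hν⟩ := ha'
      have := hν 0
      rw [hΨ0, add_zero, torusHeight_inl] at this
      rw [← this, Q.symm_apply_apply]
    | zero => rw [map_zero]; rfl
    | add x y _ _ hx hy => rw [map_add, Prod.snd_add, hx, hy, add_zero]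
    | smul t x _ hx => rw [map_smul, Prod.smul_snd, hx, smul_zero]
  have hVmem : ∀ w, Q (w, 0) ∈ V := by
    intro w
    have h1 : (⊤ : Submodule ℝ (E m)) ≤ V.comap (Q.toLinearMap.comp (LinearMap.inl ℝ (E m) ℝ)) := by
      rw [← hM.span_translations, Submodule.span_le]
      rintro _ ⟨τ, hτ, hl, rfl⟩
      refine Submodule.subset_span ⟨⟨τ, hτ⟩, fun y => ?_⟩
      obtain ⟨u, rfl⟩ := Q.surjective y
      have hl' : (⟨τ, hτ⟩ : M) ∈ translationSubgroup M := hl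
      rw [hΨQ, hρT _ hl', hcT _ hl', torusHeight_inl]
      exact map_add Q (τ 0, 0) u
    exact h1 trivial
  have hVperp : ∀ w ∈ Vᗮ, (Q.symm w).1 = 0 := by
    intro w hw
    obtain ⟨u, rfl⟩ := Q.surjective w
    rw [Q.symm_apply_apply]
    have h1 := hw _ (hVmem u.1)
    have h2 := hQ (u.1, 0) (u.1, 0)
    rw [hQ] at h1
    simp only [zero_mul] at h1 h2
    rw [h1, inner_self_eq_zero] at h2
    have h3 := Q.map_eq_zero_iff.1 h2
    exact congrArg Prod.fst h3
  refine ⟨Ψ, V, ?_, ⟨?_, ?_⟩, rfl, fun x => ⟨fun hx => ⟨?_, ?_⟩, fun hx => ?_⟩⟩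
  -- A kernel element has height zero, so it lies in the fiber; its linear part is trivial, so it is
  -- a translation, and its vector is c x = 0.
  · refine (injective_iff_map_eq_one Ψ).2 fun x hx => ?_
    have h1 := hΨ0 x
    rw [hx] at h1
    have h2 := Q.map_eq_zero_iff.1 h1.symm
    have hx1 := eq_inl_of_right_eq_one (torusHeight_eq_zero_iff.1 (congrArg Prod.snd h2))
    have h3 : c x = 0 := congrArg Prod.fst h2
    have h4 : x.left ∈ translationSubgroup M := by
      rw [mem_translationSubgroup]
      ext1 w
      have h5 := hU x (w, 0)
      rw [← hlin, hx, map_one, LinearIsometryEquiv.coe_one, id_eq] at h5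
      have h6 := congrArg Prod.fst (Q.injective h5)
      rw [hx1, hρM] at h6
      exact h6.symm
    have h7 := hcT _ h4
    rw [← hx1, h3] at h7
    have h8 : x.left = 1 := Subtype.ext (isom_ext h7.symm (by
      rw [mem_translationSubgroup.1 h4]; exact (map_one lin).symm))
    rw [hx1, h8, map_one]
  -- Heights are integers, so moving the origin by less than 1 forces height zero, and only finitely
  -- many fiber elements have bounded c.
  · refine isDiscrete_of_finite one_pos ?_
    let Qc := Q.symm.toContinuousLinearEquiv
    have hbd := (finite_bounded_cocycle hM (c := fun ν => c (SemidirectProduct.inl ν)) (by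
      intro τ hτ ν
      rw [map_mul, hc, hρT τ hτ, hcT τ hτ]; rfl) ‖(Qc : E (m + 1) →L[ℝ] E m × ℝ)‖).image
        fun ν => Ψ (SemidirectProduct.inl ν)
    refine hbd.subset ?_
    rintro _ ⟨⟨x, rfl⟩, hx⟩
    rw [hΨ0] at hx
    have h1 : |torusHeight x| < 1 := by
      have h2 := hnorm (c x) (torusHeight x)
      have h3 : ‖Q (c x, torusHeight x)‖ ^ 2 < 1 := by
        have := norm_nonneg (Q (c x, torusHeight x))
        nlinarith
      exact (sq_lt_one_iff_abs_lt_one _).1 (h2.trans_lt h3)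
    have h4 := right_eq_one_of_abs_torusHeight_lt h1
    refine ⟨x.left, ?_, congrArg Ψ (eq_inl_of_right_eq_one h4).symm⟩
    simp only [Set.mem_ofPred_eq]
    rw [← eq_inl_of_right_eq_one h4]
    have h5 := (Qc : E (m + 1) →L[ℝ] E m × ℝ).le_opNorm (Q (c x, torusHeight x))
    have h6 : (Qc : E (m + 1) →L[ℝ] E m × ℝ) (Q (c x, torusHeight x)) = (c x, torusHeight x) :=
      Q.symm_apply_apply _
    rw [h6] at h5
    refine (norm_fst_le (c x, torusHeight x)).trans (h5.trans ?_)
    exact mul_le_of_le_one_right (norm_nonneg _) hx.le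
  · obtain ⟨R, hR⟩ := hM.exists_translations_covering
    let Qc := Q.toContinuousLinearEquiv
    refine compactSpace_of_covering_radius
      (R := ‖(Qc : (E m × ℝ) →L[ℝ] E (m + 1))‖ * max R 1) fun y => ?_
    obtain ⟨u, rfl⟩ := Q.surjective y
    -- A power of the stable letter brings the last coordinate into [0, 1); a translation of M then
    -- brings the rest within R without changing the height.
    let t : MappingTorus φ := SemidirectProduct.inr (Multiplicative.ofAdd (-⌊u.2⌋))
    have ht : torusHeight t = -⌊u.2⌋ := by
      rw [torusHeight_inr, Int.cast_neg]
    obtain ⟨_, ⟨τ, hτ, hl, rfl⟩, hd⟩ := hR (c t + ρ t u.1)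
    have hl' : (⟨τ, hτ⟩ : M)⁻¹ ∈ translationSubgroup M := Subgroup.inv_mem _ hl
    refine ⟨_, ⟨SemidirectProduct.inl (⟨τ, hτ⟩ : M)⁻¹ * t, rfl⟩, ?_⟩
    rw [map_mul, isom_mul_apply, hΨQ, hΨQ, hρT _ hl', hcT _ hl', torusHeight_inl, ht]
    have h1 : (((⟨τ, hτ⟩ : M)⁻¹ : M) : Isom m) 0 = - τ 0 := by
      change τ⁻¹ 0 = _
      rw [isom_inv_zero, map_inv, hl, inv_one]; rfl
    refine ((Qc : (E m × ℝ) →L[ℝ] E (m + 1)).le_opNorm _).trans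
      (mul_le_mul_of_nonneg_left ?_ (norm_nonneg _))
    refine max_le_max ?_ ?_
    · simp only [h1, Module.End.one_apply]
      rw [neg_add_eq_sub]
      exact hd
    · simp only [zero_add, neg_add_eq_sub]
      rw [Int.self_sub_floor, Real.norm_eq_abs, abs_of_nonneg (Int.fract_nonneg _)]
      exact (Int.fract_lt_one _).le
  · rw [hΨ0]
    rw [torusHeight_eq_zero_iff.2 hx]
    exact hVmem _
  · intro w hw
    have h1 := hVperp w hw
    obtain ⟨u, rfl⟩ := Q.surjective w
    rw [Q.symm_apply_apply] at h1
    rw [hlin, hU, h1, map_zero]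
    congr 1
    exact Prod.ext h1.symm rfl
  · have h1 := hVsub _ hx.1
    rw [hΨ0, Q.symm_apply_apply] at h1
    exact torusHeight_eq_zero_iff.1 h1

end Realization


/-! ### Pairs realizing outer automorphisms of finite order -/

section Correspondence

variable {m : ℕ} {M : Subgroup (Isom m)}

lemma zpowers_mk_ker_eq_top {G : Type*} [Group G] (f : G →* Multiplicative ℤ) {y : G}
    (hy : f y = Multiplicative.ofAdd 1) :
    Subgroup.zpowers (QuotientGroup.mk y : G ⧸ f.ker) = ⊤ := by
  refine eq_top_iff.2 fun x _ => ?_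
  obtain ⟨x, rfl⟩ := QuotientGroup.mk_surjective x
  refine ⟨Multiplicative.toAdd (f x), ?_⟩
  change ((y ^ Multiplicative.toAdd (f x) : G) : G ⧸ f.ker) = x
  rw [QuotientGroup.eq, MonoidHom.mem_ker, map_mul, map_inv, map_zpow, hy, inv_mul_eq_one,
    ← ofAdd_zsmul, smul_eq_mul, mul_one, ofAdd_toAdd]

lemma infinite_quotient_ker {G : Type*} [Group G] {f : G →* Multiplicative ℤ}
    (hf : Function.Surjective f) : Infinite (G ⧸ f.ker) :=
  Infinite.of_injective _ (QuotientGroup.quotientKerEquivOfSurjective f hf).symm.injective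

/-- The fiber of a group identified with a mapping torus group, and the stable letter. -/
lemma exists_fiber_equiv {G H : Type} [Group G] [Group H] {φ : MulAut G} (e : MappingTorus φ ≃* H)
    (f : H →* Multiplicative ℤ) (hf : ∀ x, f (e x) = x.right) :
    ∃ (α : f.ker ≃* G) (γ : H), Subgroup.zpowers (QuotientGroup.mk γ : H ⧸ f.ker) = ⊤ ∧
      Infinite (H ⧸ f.ker) ∧ MulAut.congr α (MulAut.conjNormal γ) = φ := by
  have hmem : ∀ x, e x ∈ f.ker ↔ x.right = 1 := fun x => by rw [MonoidHom.mem_ker, hf]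
  let j : G →* f.ker := (e.toMonoidHom.comp SemidirectProduct.inl).codRestrict f.ker
    fun ν => (hmem (SemidirectProduct.inl ν)).2 rfl
  have hj : ∀ ν, (j ν : H) = e (SemidirectProduct.inl ν) := fun _ => rfl
  have hjb : Function.Bijective j := by
    constructor
    · intro ν ν' hνν
      have h1 := congrArg Subtype.val hνν
      rw [hj, hj] at h1
      exact SemidirectProduct.inl_injective (e.injective h1)
    · rintro ⟨y, hy⟩
      obtain ⟨x, rfl⟩ := e.surjective y
      refine ⟨x.left, Subtype.ext ?_⟩
      rw [hj, ← eq_inl_of_right_eq_one ((hmem x).1 hy)]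
  let t : MappingTorus φ := SemidirectProduct.inr (Multiplicative.ofAdd 1)
  have hsurj : Function.Surjective f := fun i => ⟨e (SemidirectProduct.inr i), by rw [hf]; rfl⟩
  refine ⟨(MulEquiv.ofBijective j hjb).symm, e t, zpowers_mk_ker_eq_top f (hf t),
    infinite_quotient_ker hsurj, ?_⟩
  ext ν
  rw [congr_conjNormal_apply, MulEquiv.symm_symm, MulEquiv.symm_apply_eq]
  refine Subtype.ext ?_
  rw [MulAut.conjNormal_apply]
  change e t * e (SemidirectProduct.inl ν) * (e t)⁻¹ = e (SemidirectProduct.inl (φ ν))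
  rw [← map_mul, ← map_inv, ← map_mul, ← inl_torusConj]
  congr 2
  rw [torusConj_apply]
  simp [t]

/-- Every automorphism of finite outer order is induced by a pair. -/
lemma exists_pair (hM : IsSpaceGroup M) (φ : MulAut M) {k : ℕ} (hk : 0 < k)
    (h : φ ^ k ∈ Inn M) :
    ∃ (P : Pair (m + 1)) (α : P.N ≃* M) (γ : P.Γ),
      Subgroup.zpowers (QuotientGroup.mk γ : P.Γ ⧸ P.N) = ⊤ ∧ Infinite (P.Γ ⧸ P.N) ∧
      MulAut.congr α (MulAut.conjNormal γ) = φ := by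
  obtain ⟨μ, hμ⟩ := h
  obtain ⟨K, hK, σ, hσ, hφ⟩ := exists_fixed_of_pow_eq_conj φ hk hμ.symm
  obtain ⟨Ψ, V, hinj, hsg, hV, hcomp⟩ := exists_realization hM φ hK hσ hφ
  let e : MappingTorus φ ≃* Ψ.range := MonoidHom.ofInjective hinj
  have he : ∀ x, (e x : Isom (m + 1)) = Ψ x := fun _ => rfl
  obtain ⟨f, hf⟩ : ∃ f : Ψ.range →* Multiplicative ℤ, ∀ x, f (e x) = x.right :=
    ⟨SemidirectProduct.rightHom.comp e.symm.toMonoidHom,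
      fun x => congrArg SemidirectProduct.right (e.symm_apply_apply x)⟩
  clear_value e
  have hmem : ∀ x, e x ∈ f.ker ↔ x.right = 1 := fun x => by rw [MonoidHom.mem_ker, hf]
  have hspan : span f.ker = V := by
    rw [hV, span]
    congr 1
    ext a
    constructor
    · rintro ⟨ν, hν, ha⟩
      obtain ⟨x, rfl⟩ := e.surjective ν
      refine ⟨x.left, fun y => ?_⟩
      rw [← ha, he, ← eq_inl_of_right_eq_one ((hmem x).1 hν)]
    · rintro ⟨ν, hν⟩
      refine ⟨e (SemidirectProduct.inl ν), (hmem _).2 rfl, fun y => ?_⟩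
      rw [he, hν]
  obtain ⟨α, γ, hγ, hinf, hα⟩ := exists_fiber_equiv e f hf
  exact ⟨
    { Γ := Ψ.range
      isSpaceGroup := hsg
      N := f.ker
      normal := MonoidHom.normal_ker _
      complete := by
        intro γ
        obtain ⟨x, rfl⟩ := e.surjective γ
        rw [hmem, hspan, he]
        exact hcomp x }, α, γ, hγ, hinf, hα⟩

lemma exists_generator_of_equiv {G D : Type} [Group G] [Group D] (e : G ≃* D) [IsCyclic D] :
    ∃ g : G, Subgroup.zpowers g = ⊤ := by
  have : IsCyclic G := isCyclic_of_surjective e.symm e.symm.surjective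
  obtain ⟨g, hg⟩ := IsCyclic.exists_generator (α := G)
  exact ⟨g, eq_top_iff.2 fun x _ => hg x⟩

end Correspondence

end SpaceGroup

end

/-! ### The classification -/

theorem theorem23 (m : ℕ)
    (M : Subgroup (SpaceGroup.Isom m)) (hM : SpaceGroup.IsSpaceGroup M)
    (Δ : Subgroup (SpaceGroup.Isom 1)) (hΔ : SpaceGroup.IsSpaceGroup Δ)
    (hcyc : IsCyclic Δ) (hinf : Infinite Δ) :
    ∃ F : SpaceGroup.Iso Δ M ≃ SpaceGroup.InversePairClasses (SpaceGroup.Out M),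
      ∀ (P : SpaceGroup.PairsOver (m + 1) Δ M) (α : P.1.N ≃* M) (γ : P.1.Γ),
        Subgroup.zpowers (QuotientGroup.mk γ : P.1.Γ ⧸ P.1.N) = ⊤ →
          (F (SpaceGroup.Iso.mk P) : Quotient (SpaceGroup.pairConj (SpaceGroup.Out M))) =
            SpaceGroup.pairClass (SpaceGroup.outClass α γ) (SpaceGroup.outClass α γ⁻¹) := by
  open SpaceGroup in
  have hiso : ∀ P : PairsOver (m + 1) Δ M, Nonempty (P.1.N ≃* M) := fun P => P.2.1
  have hquot : ∀ P : PairsOver (m + 1) Δ M, Infinite (P.1.Γ ⧸ P.1.N) := fun P =>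
    Infinite.of_injective _ P.2.2.some.symm.injective
  have hgen : ∀ P : PairsOver (m + 1) Δ M, ∃ γ : P.1.Γ,
      Subgroup.zpowers (QuotientGroup.mk γ : P.1.Γ ⧸ P.1.N) = ⊤ := by
    intro P
    obtain ⟨g, hg⟩ := exists_generator_of_equiv P.2.2.some
    obtain ⟨γ, rfl⟩ := QuotientGroup.mk_surjective g
    exact ⟨γ, hg⟩
  choose g hg using hgen
  let a : ∀ P : PairsOver (m + 1) Δ M, P.1.N ≃* M := fun P => (hiso P).some
  have hfin : ∀ P : PairsOver (m + 1) Δ M, IsOfFinOrder (outClass (a P) (g P)) := fun P =>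
    have := P.1.isSpaceGroup.finiteIndex_translationSubgroup
    isOfFinOrder_outClass (a P) (translationSubgroup P.1.Γ)
      (translationSubgroup_comm P.1.Γ) (g P)
  let c : PairsOver (m + 1) Δ M → InversePairClasses (Out M) := fun P =>
    ⟨pairClass (outClass (a P) (g P)) (outClass (a P) (g P))⁻¹, _, hfin P, rfl⟩
  let F : Iso Δ M → InversePairClasses (Out M) := Quotient.lift c (by
    rintro P Q ⟨φ, hφ⟩
    have := hquot Q
    exact Subtype.ext (pairClass_eq_of_map φ hφ (a P) (a Q) (hg P) (hg Q)))
  have hF : ∀ (P : PairsOver (m + 1) Δ M) (α : P.1.N ≃* M) (γ : P.1.Γ),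
      Subgroup.zpowers (QuotientGroup.mk γ : P.1.Γ ⧸ P.1.N) = ⊤ →
        (F (Iso.mk P) : Quotient (pairConj (Out M))) =
          pairClass (outClass α γ) (outClass α γ)⁻¹ := by
    intro P α γ hγ
    have := hquot P
    -- Invariance under the identity isomorphism is independence of the chosen `a P` and `g P`.
    exact pairClass_eq_of_map (MulEquiv.refl P.1.Γ) (Subgroup.map_id P.1.N) (a P) α (hg P) hγ
  have hFinj : Function.Injective F := by
    intro x y hxy
    induction x using Quotient.ind with
    | _ P =>
    induction y using Quotient.ind with
    | _ Q =>
    refine Quotient.sound ?_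
    have := hquot P
    have := hquot Q
    obtain ⟨o, ho | ho⟩ := pairClass_eq_iff (congrArg Subtype.val hxy)
    · exact exists_equiv_of_conj (a P) (a Q) (hg P) (hg Q) ho
    -- If the conjugate is the inverse, the inverse generator of the second quotient is used
    -- instead.
    · rw [← outClass_inv] at ho
      exact exists_equiv_of_conj (a P) (a Q) (hg P) (zpowers_mk_inv (hg Q)) ho
  have hFsurj : Function.Surjective F := by
    rintro ⟨_, o, ho, rfl⟩
    obtain ⟨φ, rfl⟩ := QuotientGroup.mk_surjective o
    obtain ⟨k, hk, hpow⟩ := isOfFinOrder_iff_pow_eq_one.1 ho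
    rw [← QuotientGroup.mk_pow, QuotientGroup.eq_one_iff] at hpow
    obtain ⟨P, α, γ, hγ, hPinf, hα⟩ := exists_pair hM φ hk hpow
    have hPcyc : IsCyclic (P.Γ ⧸ P.N) := ⟨_, fun x => hγ ▸ Subgroup.mem_top x⟩
    -- Both groups are infinite cyclic; `Nat.card` is 0 on infinite types, so the cardinality
    -- criterion for cyclic groups applies.
    have hcard : Nat.card (P.Γ ⧸ P.N) = Nat.card Δ := by
      rw [Nat.card_eq_zero_of_infinite, Nat.card_eq_zero_of_infinite]
    let P' : PairsOver (m + 1) Δ M := ⟨P, ⟨α⟩, ⟨mulEquivOfCyclicCardEq hcard⟩⟩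
    refine ⟨Iso.mk P', Subtype.ext ?_⟩
    rw [hF P' α γ hγ]
    have : outClass α γ = (QuotientGroup.mk φ : Out M) := congrArg _ hα
    change pairClass (outClass α γ) (outClass α γ)⁻¹ = _
    rw [this]
  refine ⟨Equiv.ofBijective F ⟨hFinj, hFsurj⟩, fun P α γ hγ => ?_⟩
  rw [outClass_inv]
  exact hF P α γ hγ
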